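/- Let $N\ge 0$, and let $M\subset\mathbb{R}^N$ (with the Euclidean norm) be closed and path-connected. The reach of a nonempty closed set $S\subset\mathbb{R}^N$ is $$\tau_S=\sup\{r>0 : \text{every } z\in\mathbb{R}^N \text{ with } d(z,S)<r \text{ has a unique nearest point in } S\}\in[0,\infty],$$ with $\sup\emptyset=0$. Let $f:M\to(0,\infty)$. For a Lipschitz path $\gamma:[a,b]\to M$, $a<b$, put $|\gamma|_f=\int_a^b f(\gamma(t))\,\|\dot\gamma(t)\|\,dt$, and for $x,y\in M$ let $D_{M,f}(x,y)$ be the infimum of $|\gamma|_f$ over all Lipschitz paths $\gamma:[a,b]\to M$ (over all segments $[a,b]$ with $a<b$) with $\gamma(a)=x$ and $\gamma(b)=y$. A minimizing geodesic of $D_{M,f}$ is such a path between two distinct points $x\neq y$ of $M$ with $|\gamma|_f=D_{M,f}(x,y)$; its reach $\tau_\gamma$ is the reach of the curve $\gamma([a,b])\subset\mathbb{R}^N$. The conformal reach of $M$ via $f$ is $$\tau_{M,f}=\inf\{\tau_\gamma : \gamma \text{ a minimizing geodesic of } D_{M,f}\}\in[0,\infty],\qquad \inf\emptyset=\infty.$$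 Suppose that $M$ has reach $\tau_M>0$, and that $f$ is $\kappa$-Lipschitz on $M$ with respect to the Euclidean norm, for some $\kappa\ge 0$, with $f\ge f_{\min}$ on $M$ for some constant $f_{\min}>0$. Then every minimizing geodesic $\gamma$ of $D_{M,f}$ has positive reach $\tau_\gamma>0$. More precisely, $$\tau_{M,f}\ \ge\ \min\left(\frac{\tau_M}{2},\ \frac{f_{\min}}{8\kappa}\right),$$ where $f_{\min}/(8\kappa)=\infty$ if $\kappa=0$ and $\tau_M/2=\infty$ if $\tau_M=\infty$. -/

import Mathlib

open Set
open scoped NNReal ENNReal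

namespace ConformalMetric

/-- The reach of `S ⊆ ℝ^N`: the supremum in `[0, ∞]` of all real `r > 0` such that every point of
the open offset `{z | d(z, S) < r}` has a unique projection (nearest point) onto `S`. -/
noncomputable def reach {N : ℕ} (S : Set (EuclideanSpace ℝ (Fin N))) : ℝ≥0∞ :=
  ⨆ (r : ℝ) (_ : 0 < r ∧ ∀ z ∈ Metric.thickening r S, ∃! p, p ∈ S ∧ dist z p = Metric.infDist z S),
    ENNReal.ofReal r

/-- `γ`, restricted to the nontrivial segment `[a, b]`, is a Lipschitz path in `M` from `x` to `y`.
Values of `γ` outside `[a, b]` are irrelevant. -/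
structure IsLipschitzPath {N : ℕ} (M : Set (EuclideanSpace ℝ (Fin N)))
    (x y : EuclideanSpace ℝ (Fin N)) (a b : ℝ) (γ : ℝ → EuclideanSpace ℝ (Fin N)) : Prop where
  lt : a < b
  lipschitz : ∃ L : ℝ≥0, LipschitzOnWith L γ (Icc a b)
  mapsTo : MapsTo γ (Icc a b) M
  source : γ a = x
  target : γ b = y

/-- The conformal length `∫_a^b f(γ(t)) ‖γ'(t)‖ dt`; a Lipschitz path is differentiable at almost
every `t ∈ (a, b)`. -/
noncomputable def conformalLength {N : ℕ} (f : EuclideanSpace ℝ (Fin N) → ℝ) (a b : ℝ)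
    (γ : ℝ → EuclideanSpace ℝ (Fin N)) : ℝ :=
  ∫ t in a..b, f (γ t) * ‖deriv γ t‖

/-- The conformal distance: the infimum in `[0, ∞]` of the conformal lengths of all Lipschitz
paths in `M` from `x` to `y`, over all nontrivial segments. -/
noncomputable def conformalDist {N : ℕ} (M : Set (EuclideanSpace ℝ (Fin N)))
    (f : EuclideanSpace ℝ (Fin N) → ℝ) (x y : EuclideanSpace ℝ (Fin N)) : ℝ≥0∞ :=
  ⨅ (a : ℝ) (b : ℝ) (γ : ℝ → EuclideanSpace ℝ (Fin N)) (_ : IsLipschitzPath M x y a b γ),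
    ENNReal.ofReal (conformalLength f a b γ)

/-- `γ : [a, b] → M` is a minimizing geodesic from `x` to `y` for the conformal metric. -/
structure IsGeodesic {N : ℕ} (M : Set (EuclideanSpace ℝ (Fin N)))
    (f : EuclideanSpace ℝ (Fin N) → ℝ) (x y : EuclideanSpace ℝ (Fin N)) (a b : ℝ)
    (γ : ℝ → EuclideanSpace ℝ (Fin N)) : Prop where
  isPath : IsLipschitzPath M x y a b γ
  minimizing : ENNReal.ofReal (conformalLength f a b γ) = conformalDist M f x y

/-- The conformal reach of `M` via `f`: the infimum in `[0, ∞]` of the reaches of the images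
`γ([a, b])` of all minimizing geodesics `γ` between distinct points of `M`. -/
noncomputable def conformalReach {N : ℕ} (M : Set (EuclideanSpace ℝ (Fin N)))
    (f : EuclideanSpace ℝ (Fin N) → ℝ) : ℝ≥0∞ :=
  ⨅ (x ∈ M) (y ∈ M) (_ : x ≠ y) (a : ℝ) (b : ℝ) (γ : ℝ → EuclideanSpace ℝ (Fin N))
    (_ : IsGeodesic M f x y a b γ), reach (γ '' Icc a b)

end ConformalMetric

/-!
Let `2 R < reach M` and `8 κ R ≤ fmin`; points at distance less than `T = 2 R` from `M` have a
unique nearest point in `M`. Suppose that a point `z` at distance `r < R` from a minimizing geodesic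
has two nearest points `p ≠ q` on it. The arc between `p` and `q` avoids the open ball of radius
`r` around `z`; a path in `M` from `p` to `q` of smaller conformal length gives a contradiction.

*Projection.* Uniqueness of nearest points makes the distance to `M` increase at unit rate away
from `M` up to height `T`; this gives Federer's inequality
`2 T ⟪x - p, q - p⟫ ≤ d(x, M) |q - p| ^ 2` for a nearest point `p` of `x` and `q ∈ M`
(`inner_le_of_uniqueProjection`). It follows that projecting a path at distance `d` from `M`
increases its speed at most by `1 / (1 - d / T)` (`norm_deriv_proj_le`).

*Confinement.* The projection of the segment `[p, q]` to `M` shows that the arc has length at most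
`8 / 5 * |p - q|` (`IsShortest.integral_norm_deriv_le`), so by Ptolemy's inequality the arc stays
in the ball of radius `8 / 5 * r` around `z` (`IsShortest.dist_le`).

*Variation.* The points of the arc are moved towards `z`, `γ ↦ γ - ε φ (γ - z)` with `φ ≥ 0`
vanishing at the endpoints and increasing with `|γ - z|`, and then projected to `M`. The
first-order change of the conformal length is at most
`-∫ φ (1 - |γ - z| (κ / fmin + 1 / T)) f ‖γ'‖`: moving shortens the arc by the factor `1 - ε φ`,
while `κ / fmin` and `1 / T` account for the variation of `f` and for the projection. Confinement
makes the integrand nonnegative, so minimality forces `φ = 0`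
(`IsShortest.eq_zero_of_monotone`). The choice `φ = |γ - z| ^ 2 - r ^ 2` shows that the arc lies
on the sphere, where every `φ` is admissible; the choice `φ = |γ - p| ^ 2 |γ - q| ^ 2` then
confines the arc to `{p, q}`, which is impossible (`IsShortest.exists_dist_lt`).

No regularity of the geodesic beyond the Lipschitz property enters.
-/

namespace ConformalMetric

open Metric MeasureTheory Filter Topology

/-! ### Nearest points -/

section NearestPoint

variable {E : Type*} [MetricSpace E]

/-- Every point of the open offset of radius `T` of `M` has a unique nearest point in `M`. -/
def UniqueProjection (M : Set E) (T : ℝ) : Prop :=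
  ∀ z ∈ thickening T M, ∃! p, p ∈ M ∧ dist z p = infDist z M

theorem UniqueProjection.mono {M : Set E} {S T : ℝ} (h : UniqueProjection M T) (hST : S ≤ T) :
    UniqueProjection M S :=
  fun z hz => h z (thickening_mono hST M hz)

open Classical in
/-- A nearest point of `x` in `M`, and `x` itself if there is none. -/
noncomputable def proj (M : Set E) (x : E) : E :=
  if h : ∃ p ∈ M, dist x p = infDist x M then h.choose else x

section

variable [ProperSpace E] {M : Set E} (hM : IsClosed M) (hne : M.Nonempty)
include hM hne

theorem exists_nearest (x : E) : ∃ p ∈ M, dist x p = infDist x M := by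
  obtain ⟨p, hp, h⟩ := hM.exists_infDist_eq_dist hne x
  exact ⟨p, hp, h.symm⟩

theorem proj_mem (x : E) : proj M x ∈ M := by
  rw [proj, dif_pos (exists_nearest hM hne x)]
  exact (exists_nearest hM hne x).choose_spec.1

theorem dist_proj (x : E) : dist x (proj M x) = infDist x M := by
  rw [proj, dif_pos (exists_nearest hM hne x)]
  exact (exists_nearest hM hne x).choose_spec.2

theorem proj_eq_self {x : E} (hx : x ∈ M) : proj M x = x := by
  have := dist_proj hM hne x
  rw [infDist_zero_of_mem hx, dist_eq_zero] at this
  exact this.symm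

end

end NearestPoint

/-! ### Federer's inequality and the projection onto a set of positive reach -/

section Projection

variable {E : Type*} [NormedAddCommGroup E] [InnerProductSpace ℝ E]

/-- The distance to `M` increases at unit rate in the direction pointing away from the unique
nearest point. -/
theorem exists_infDist_ge_of_existsUnique [ProperSpace E] {M : Set E} (hM : IsClosed M) {y p : E}
    (hp : p ∈ M) (hyp : dist y p = infDist y M) (hpos : 0 < infDist y M)
    (huniq : ∀ q ∈ M, dist y q = infDist y M → q = p) {ε σ : ℝ} (hε : 0 < ε) (hε1 : ε < 1)
    (hσ : 0 < σ) :
    ∃ y', 0 < dist y' y ∧ dist y' y < σ ∧ infDist y M + (1 - ε) * dist y' y ≤ infDist y' M := by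
  have hne : M.Nonempty := ⟨p, hp⟩
  set δ := infDist y M with hδ
  set u : E := δ⁻¹ • (y - p) with hu
  have hup : ‖u‖ = 1 := by
    rw [hu, norm_smul, ← dist_eq_norm, hyp, Real.norm_of_nonneg (inv_nonneg.2 hpos.le)]
    exact inv_mul_cancel₀ hpos.ne'
  have huy : inner ℝ u (y - p) = δ := by
    rw [hu, inner_smul_left, real_inner_self_eq_norm_sq, ← dist_eq_norm, hyp]
    simp only [conj_trivial]
    field_simp
  -- Points of `M` near the sphere around `y` make an angle close to `0` with `p` as seen from `y`.
  obtain ⟨η, hη, hηK⟩ : ∃ η > 0, ∀ q ∈ M, dist y q < δ + η → (1 - ε) * δ < inner ℝ u (y - q) := by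
    set K : Set E := {q | q ∈ M ∧ dist y q ≤ δ + 1 ∧ inner ℝ u (y - q) ≤ (1 - ε) * δ} with hK
    have hKc : IsCompact K := by
      apply (isCompact_closedBall y (δ + 1)).of_isClosed_subset
      · refine hM.inter (IsClosed.inter ?_ ?_)
        · exact isClosed_le (f := fun q => dist y q) (by fun_prop) continuous_const
        · exact isClosed_le (f := fun q => inner ℝ u (y - q)) (by fun_prop) continuous_const
      · intro q hq
        rw [mem_closedBall, dist_comm]; exact hq.2.1
    rcases K.eq_empty_or_nonempty with hKe | hKne
    · refine ⟨1, one_pos, fun q hq hd => ?_⟩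
      by_contra hcon
      have : q ∈ K := ⟨hq, hd.le, not_lt.1 hcon⟩
      simp [hKe] at this
    · obtain ⟨q₀, hq₀, hmin⟩ := hKc.exists_isMinOn hKne
        (f := fun q => dist y q) (by fun_prop)
      have hlt : δ < dist y q₀ := by
        rcases (infDist_le_dist_of_mem hq₀.1 : infDist y M ≤ dist y q₀).lt_or_eq with h | h
        · exact h
        · have := huniq q₀ hq₀.1 h.symm
          have h2 := hq₀.2.2
          rw [this, huy] at h2
          nlinarith
      refine ⟨min 1 (dist y q₀ - δ), lt_min one_pos (sub_pos.2 hlt), fun q hq hd => ?_⟩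
      by_contra hcon
      have h1 : dist y q ≤ δ + 1 := hd.le.trans (by gcongr; exact min_le_left _ _)
      have h2 := hmin (show q ∈ K from ⟨hq, h1, not_lt.1 hcon⟩)
      have h3 : min 1 (dist y q₀ - δ) ≤ dist y q₀ - δ := min_le_right _ _
      simp only [mem_ofPred_eq] at h2
      linarith
  set h : ℝ := min (σ / 2) (η / 3) with hh
  have hh0 : 0 < h := by positivity
  have hd : dist (y + h • u) y = h := by
    rw [dist_eq_norm, add_sub_cancel_left, norm_smul, hup, Real.norm_of_nonneg hh0.le, mul_one]
  refine ⟨y + h • u, by rwa [hd], ?_, ?_⟩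
  · rw [hd]; exact (min_le_left _ _).trans_lt (by linarith)
  · rw [hd]
    obtain ⟨q, hq, hqd⟩ := hM.exists_infDist_eq_dist hne (y + h • u)
    have h1 : infDist (y + h • u) M ≤ δ + h := by
      have := infDist_le_infDist_add_dist (s := M) (x := y + h • u) (y := y)
      rw [hd] at this; exact this
    have h2 : dist y q < δ + η := by
      have := dist_triangle y (y + h • u) q
      rw [dist_comm y (y + h • u), hd, ← hqd] at this
      have h3 : h ≤ η / 3 := min_le_right _ _
      linarith
    have h3 := hηK q hq h2
    have h4 : δ ≤ dist y q := infDist_le_dist_of_mem hq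
    have h5 : dist (y + h • u) q ^ 2 = dist y q ^ 2 + 2 * h * inner ℝ u (y - q) + h ^ 2 := by
      rw [dist_eq_norm, show y + h • u - q = (y - q) + h • u by abel, norm_add_sq_real,
        inner_smul_right, real_inner_comm, norm_smul, hup, Real.norm_of_nonneg hh0.le, dist_eq_norm]
      ring
    rw [hqd]
    have h6 : 0 < 1 - ε := by linarith
    refine (abs_le_of_sq_le_sq' ?_ dist_nonneg).2
    rw [h5]
    nlinarith [mul_pos hh0 (sub_pos.2 h3), mul_pos hh0 hh0, mul_pos hh0 h6, mul_pos hε hh0,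
      mul_pos (mul_pos hh0 hh0) hε, mul_pos (mul_pos (mul_pos hh0 hh0) hε) h6]

/-- Within the offset of unique projection, the distance to `M` attains on the closed ball of
radius `t` the largest value that the Lipschitz bound allows. -/
theorem exists_infDist_eq_add [ProperSpace E] {M : Set E} (hM : IsClosed M) (hne : M.Nonempty)
    {T : ℝ} (hU : UniqueProjection M T) {x : E} (hx : 0 < infDist x M) {t : ℝ} (ht : 0 < t)
    (hxt : infDist x M + t < T) :
    ∃ y, dist y x ≤ t ∧ infDist x M + t ≤ infDist y M := by
  have hcont : Continuous fun y : E => infDist y M := continuous_infDist_pt M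
  have key : ∀ ε : ℝ, 0 < ε → ε < 1 →
      ∃ y, dist y x ≤ t ∧ infDist x M + (1 - ε) * t ≤ infDist y M := by
    intro ε hε hε1
    -- A maximizer of `d(·, M) - (1 - ε) |· - x|` lies on the boundary of the ball: elsewhere it
    -- could be improved by moving away from its nearest point.
    obtain ⟨y, hy, hmax⟩ := (isCompact_closedBall x t).exists_isMaxOn
      (nonempty_closedBall.2 ht.le)
      (f := fun y => infDist y M - (1 - ε) * dist y x) (by fun_prop)
    rw [mem_closedBall] at hy
    have hyx : infDist x M ≤ infDist y M - (1 - ε) * dist y x := by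
      have := hmax (mem_closedBall_self ht.le)
      simpa using this
    rcases hy.lt_or_eq with hlt | heq
    · exfalso
      have h0 : (0 : ℝ) ≤ dist y x := dist_nonneg
      have hy0 : 0 < infDist y M := by nlinarith
      have hyT : infDist y M < T := by
        have := infDist_le_infDist_add_dist (s := M) (x := y) (y := x)
        linarith
      obtain ⟨p, ⟨hp, hyp⟩, hun⟩ := hU y ((mem_thickening_iff_infDist_lt hne).2 hyT)
      obtain ⟨y', h1, h2, h3⟩ := exists_infDist_ge_of_existsUnique hM hp hyp hy0
        (fun q hq hqd => hun q ⟨hq, hqd⟩) (half_pos hε) (by linarith) (sub_pos.2 hlt)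
      have h4 : dist y' x ≤ dist y' y + dist y x := dist_triangle _ _ _
      have h5 := hmax (show y' ∈ closedBall x t by rw [mem_closedBall]; linarith)
      simp only [mem_ofPred_eq] at h5
      nlinarith
    · refine ⟨y, hy, ?_⟩
      rw [heq] at hyx; linarith
  obtain ⟨y, hy, hmax⟩ := (isCompact_closedBall x t).exists_isMaxOn
    (nonempty_closedBall.2 ht.le) hcont.continuousOn
  refine ⟨y, hy, ?_⟩
  apply le_of_forall_pos_lt_add
  intro ε hε
  obtain ⟨w, hw, hwd⟩ := key (min (1 / 2) (ε / (2 * t))) (by positivity)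
    ((min_le_left _ _).trans_lt (by norm_num))
  have h1 : infDist w M ≤ infDist y M := hmax (mem_closedBall.2 hw)
  have h2 : min (1 / 2) (ε / (2 * t)) * t ≤ ε / 2 := by
    calc _ ≤ ε / (2 * t) * t := by gcongr; exact min_le_right _ _
      _ = ε / 2 := by field_simp
  linarith

/-- **Federer's inequality**: the normal direction at a nearest point `p` is almost orthogonal to
all chords of `M` issued from `p`. -/
theorem inner_le_of_uniqueProjection [ProperSpace E] {M : Set E} (hM : IsClosed M) {T : ℝ}
    (hU : UniqueProjection M T) {x p q : E} (hp : p ∈ M) (hxp : dist x p = infDist x M)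
    (hxT : infDist x M < T) (hq : q ∈ M) :
    2 * T * inner ℝ (x - p) (q - p) ≤ infDist x M * dist p q ^ 2 := by
  have hne : M.Nonempty := ⟨p, hp⟩
  rcases (infDist_nonneg (x := x) (s := M)).eq_or_lt with h0 | hpos
  · rw [← h0, dist_eq_zero] at hxp
    simp [hxp, infDist_zero_of_mem hp]
  set d := infDist x M with hd
  have key : ∀ t, 0 < t → d + t < T →
      2 * (d + t) * inner ℝ (x - p) (q - p) ≤ d * dist p q ^ 2 := by
    intro t ht htT
    obtain ⟨y, hyx, hyd⟩ := exists_infDist_eq_add hM hne hU hpos ht htT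
    have hyp : infDist y M ≤ dist y p := infDist_le_dist_of_mem hp
    have hyq : infDist y M ≤ dist y q := infDist_le_dist_of_mem hq
    have e1 : dist y p ^ 2 = dist y x ^ 2 + 2 * inner ℝ (y - x) (x - p) + d ^ 2 := by
      rw [← hxp, dist_eq_norm, dist_eq_norm, dist_eq_norm,
        show y - p = (y - x) + (x - p) by abel, norm_add_sq_real]
    have hd0 : 0 ≤ dist y x := dist_nonneg
    -- The triangle inequality for `y`, `x`, `p` is an equality, so the points are aligned.
    have e2 : d • (y - x) = t • (x - p) := by
      rw [← sub_eq_zero, ← norm_eq_zero, ← sq_eq_zero_iff]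
      apply le_antisymm _ (sq_nonneg _)
      rw [norm_sub_sq_real, norm_smul, norm_smul, inner_smul_left, inner_smul_right,
        ← dist_eq_norm, ← dist_eq_norm, hxp, Real.norm_of_nonneg hpos.le, Real.norm_of_nonneg ht.le]
      simp only [conj_trivial]
      have h1 : (d + t) ^ 2 ≤ dist y p ^ 2 := by gcongr; linarith
      have h2 : dist y x ^ 2 ≤ t ^ 2 := by gcongr
      have h3 : 0 ≤ d * t := by positivity
      nlinarith [mul_nonneg h3 (sub_nonneg.2 h1), mul_nonneg h3 (sub_nonneg.2 h2),
        mul_nonneg (sq_nonneg d) (sub_nonneg.2 h2)]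
    have e3 : d • (y - p) = (d + t) • (x - p) := by
      rw [show y - p = (y - x) + (x - p) by abel, smul_add, e2, add_smul, add_comm]
    have e4 : d ^ 2 * dist y q ^ 2
        = (d + t) ^ 2 * d ^ 2 - 2 * d * (d + t) * inner ℝ (x - p) (q - p)
          + d ^ 2 * dist p q ^ 2 := by
      have : d * dist y q = ‖(d + t) • (x - p) - d • (q - p)‖ := by
        rw [← e3, ← smul_sub, norm_smul, Real.norm_of_nonneg hpos.le, sub_sub_sub_cancel_right,
          dist_eq_norm]
      rw [← mul_pow, this, norm_sub_sq_real, norm_smul, norm_smul, inner_smul_left,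
        inner_smul_right, ← dist_eq_norm x, hxp, dist_comm p q, dist_eq_norm q,
        Real.norm_of_nonneg hpos.le, Real.norm_of_nonneg (by positivity : (0 : ℝ) ≤ d + t)]
      simp only [conj_trivial]
      ring
    have h5 : (d + t) ^ 2 ≤ dist y q ^ 2 := by gcongr; linarith
    have h6 : d * (2 * (d + t) * inner ℝ (x - p) (q - p)) ≤ d * (d * dist p q ^ 2) := by
      nlinarith [mul_le_mul_of_nonneg_left h5 (sq_nonneg d)]
    exact le_of_mul_le_mul_left h6 hpos
  have hlim : Tendsto (fun s : ℝ => 2 * s * inner ℝ (x - p) (q - p)) (𝓝[<] T)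
      (𝓝 (2 * T * inner ℝ (x - p) (q - p))) :=
    Tendsto.mono_left (Continuous.tendsto (by fun_prop) T) nhdsWithin_le_nhds
  refine le_of_tendsto hlim ?_
  filter_upwards [Ioo_mem_nhdsLT hxT] with s hs
  have := key (s - d) (by linarith [hs.1]) (by linarith [hs.2])
  rwa [add_sub_cancel] at this

section

variable [ProperSpace E] {M : Set E} (hM : IsClosed M) (hne : M.Nonempty)
include hM hne

/-- The projection onto `M` is Lipschitz, with a constant that tends to `1` at `M`. -/
theorem dist_proj_le {T : ℝ} (hT : 0 < T) (hU : UniqueProjection M T) {x y : E}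
    (hx : infDist x M < T) (hy : infDist y M < T) :
    dist (proj M x) (proj M y) * (1 - (infDist x M + infDist y M) / (2 * T)) ≤ dist x y := by
  set p := proj M x
  set q := proj M y
  have hp : p ∈ M := proj_mem hM hne x
  have hq : q ∈ M := proj_mem hM hne y
  have h1 := inner_le_of_uniqueProjection hM hU hp (dist_proj hM hne x) hx hq
  have h2 := inner_le_of_uniqueProjection hM hU hq (dist_proj hM hne y) hy hp
  rcases (dist_nonneg (x := p) (y := q)).eq_or_lt with h0 | hpos
  · rw [← h0, zero_mul]; exact dist_nonneg
  have h3 : inner ℝ (x - y) (p - q) ≤ dist x y * dist p q := by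
    rw [dist_eq_norm, dist_eq_norm]; exact real_inner_le_norm _ _
  have h4 : inner ℝ (x - p) (q - p) + inner ℝ (y - q) (p - q)
      = dist p q ^ 2 - inner ℝ (x - y) (p - q) := by
    rw [dist_eq_norm, ← real_inner_self_eq_norm_sq, ← neg_sub p q, inner_neg_right,
      ← inner_sub_left, neg_add_eq_sub, ← inner_sub_left]
    congr 1
    abel
  rw [dist_comm q p] at h2
  have h5 : dist p q * (dist p q * (1 - (infDist x M + infDist y M) / (2 * T)))
      ≤ dist p q * dist x y := by
    have : dist p q * (dist p q * (1 - (infDist x M + infDist y M) / (2 * T)))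
      = dist p q ^ 2 - (infDist x M * dist p q ^ 2 + infDist y M * dist p q ^ 2) / (2 * T) := by
      field_simp
    rw [this, sub_le_iff_le_add, ← sub_le_iff_le_add', le_div_iff₀ (by positivity)]
    nlinarith
  exact le_of_mul_le_mul_left h5 hpos

end

/-- A chord of `M` of length at most `T` stays within distance `T / 7` of `M`. -/
theorem infDist_segment_le [ProperSpace E] {M : Set E} (hM : IsClosed M) {T : ℝ}
    (hU : UniqueProjection M T) {p q : E} (hp : p ∈ M) (hq : q ∈ M) (hT : 0 < T)
    (hpq : dist p q ≤ T) {l : ℝ} (hl : l ∈ Icc (0 : ℝ) 1) :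
    infDist (p + l • (q - p)) M ≤ T / 7 := by
  have hne : M.Nonempty := ⟨p, hp⟩
  set x := p + l • (q - p) with hx
  set d := infDist x M with hd
  set w := proj M x with hw
  have hl0 := hl.1
  have hl1 := hl.2
  have hxp : dist x p = l * dist p q := by
    rw [dist_eq_norm, hx, add_sub_cancel_left, norm_smul, Real.norm_of_nonneg hl0, dist_comm,
      dist_eq_norm]
  have hxq : dist x q = (1 - l) * dist p q := by
    rw [dist_eq_norm, hx, show p + l • (q - p) - q = (1 - l) • (p - q) by module, norm_smul,
      Real.norm_of_nonneg (by linarith), dist_eq_norm]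
  have hc : 0 ≤ dist p q := dist_nonneg
  have hd1 : d ≤ l * dist p q := hxp ▸ infDist_le_dist_of_mem hp
  have hd2 : d ≤ (1 - l) * dist p q := hxq ▸ infDist_le_dist_of_mem hq
  -- This selects the smaller root of the quadratic inequality for `d` obtained in `h4` and `h5`.
  have hdT : d ≤ T / 2 := by nlinarith
  have h1 := inner_le_of_uniqueProjection hM hU (proj_mem hM hne x) (dist_proj hM hne x)
    (by linarith) hp
  have h2 := inner_le_of_uniqueProjection hM hU (proj_mem hM hne x) (dist_proj hM hne x)
    (by linarith) hq
  rw [← hw, ← hd] at h1 h2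
  have hxw : ‖x - w‖ = d := by rw [← dist_eq_norm]; exact dist_proj hM hne x
  have e1 : (1 - l) * inner ℝ (x - w) (p - w) + l * inner ℝ (x - w) (q - w) = d ^ 2 := by
    rw [← hxw, ← real_inner_self_eq_norm_sq, ← inner_smul_right, ← inner_smul_right,
      ← inner_add_right]
    congr 1
    rw [hx]; module
  have e2 : (1 - l) * dist w p ^ 2 + l * dist w q ^ 2 = l * (1 - l) * dist p q ^ 2 + d ^ 2 := by
    have a1 : dist w p ^ 2 = d ^ 2 - 2 * l * inner ℝ (x - w) (q - p) + l ^ 2 * dist p q ^ 2 := by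
      rw [dist_comm, dist_eq_norm, show p - w = (x - w) - l • (q - p) by rw [hx]; module,
        norm_sub_sq_real, inner_smul_right, norm_smul, hxw, mul_pow, Real.norm_of_nonneg hl0,
        dist_comm p q, dist_eq_norm]
      ring
    have a2 : dist w q ^ 2
        = d ^ 2 + 2 * (1 - l) * inner ℝ (x - w) (q - p) + (1 - l) ^ 2 * dist p q ^ 2 := by
      rw [dist_comm, dist_eq_norm, show q - w = (x - w) + (1 - l) • (q - p) by rw [hx]; module,
        norm_add_sq_real, inner_smul_right, norm_smul, hxw, mul_pow,
        Real.norm_of_nonneg (by linarith : 0 ≤ 1 - l), dist_comm p q, dist_eq_norm]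
      ring
    rw [a1, a2]; ring
  have hd0 : 0 ≤ d := infDist_nonneg
  have h3 : 2 * T * d ^ 2 ≤ d * (l * (1 - l) * dist p q ^ 2 + d ^ 2) := by
    rw [← e2, ← e1]
    -- The inequalities at `p` and `q` are combined with the barycentric weights of `x`.
    nlinarith [mul_le_mul_of_nonneg_left h1 (sub_nonneg.2 hl1), mul_le_mul_of_nonneg_left h2 hl0]
  by_contra! hcon
  have hdpos : 0 < d := by linarith
  have h4 : 2 * T * d ≤ l * (1 - l) * dist p q ^ 2 + d ^ 2 := by
    apply le_of_mul_le_mul_left _ hdpos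
    linarith
  have h5 : l * (1 - l) * dist p q ^ 2 ≤ T ^ 2 / 4 := by
    have : l * (1 - l) ≤ 1 / 4 := by nlinarith [sq_nonneg (2 * l - 1)]
    have : dist p q ^ 2 ≤ T ^ 2 := by gcongr
    nlinarith [sq_nonneg (dist p q)]
  nlinarith [mul_pos (sub_pos.2 hcon) hT]

end Projection

/-! ### Lipschitz paths and their projections -/

section LipschitzPath

theorem integral_mono_of_ae_Ioo {f g : ℝ → ℝ} {a b : ℝ} (hab : a ≤ b)
    (hf : IntervalIntegrable f volume a b) (hg : IntervalIntegrable g volume a b)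
    (h : ∀ᵐ u, u ∈ Ioo a b → f u ≤ g u) : ∫ u in a..b, f u ≤ ∫ u in a..b, g u := by
  simp only [intervalIntegral.integral_of_le hab, integral_Ioc_eq_integral_Ioo]
  exact setIntegral_mono_on_ae (hf.1.mono Ioo_subset_Ioc_self le_rfl)
    (hg.1.mono Ioo_subset_Ioc_self le_rfl) measurableSet_Ioo h

variable {E : Type*} [NormedAddCommGroup E]

theorem lipschitzOnWith_Icc_glue {F : Type*} [PseudoMetricSpace F] {γ : ℝ → F} {a c b : ℝ}
    {K : ℝ≥0} (h₁ : LipschitzOnWith K γ (Icc a c)) (h₂ : LipschitzOnWith K γ (Icc c b)) :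
    LipschitzOnWith K γ (Icc a b) := by
  have key : ∀ u ∈ Icc a b, ∀ v ∈ Icc a b, u ≤ v → dist (γ u) (γ v) ≤ K * dist u v := by
    intro u hu v hv huv
    rcases le_total v c with hvc | hcv
    · exact h₁.dist_le_mul u ⟨hu.1, huv.trans hvc⟩ v ⟨hv.1, hvc⟩
    rcases le_total c u with hcu | huc
    · exact h₂.dist_le_mul u ⟨hcu, hu.2⟩ v ⟨hcv, hv.2⟩
    have e1 := h₁.dist_le_mul u ⟨hu.1, huc⟩ c ⟨hu.1.trans huc, le_rfl⟩
    have e2 := h₂.dist_le_mul c ⟨le_rfl, hcv.trans hv.2⟩ v ⟨hcv, hv.2⟩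
    have e3 := dist_triangle (γ u) (γ c) (γ v)
    rw [Real.dist_eq, abs_sub_comm, abs_of_nonneg (by linarith)] at e1 e2 ⊢
    linarith
  refine LipschitzOnWith.of_dist_le_mul fun u hu v hv => ?_
  rcases le_total u v with h | h
  · exact key u hu v hv h
  · rw [dist_comm, dist_comm u]; exact key v hv u hu h

variable [InnerProductSpace ℝ E] [FiniteDimensional ℝ E]

theorem exists_lipschitzOnWith_comp {F : Type*} [NormedAddCommGroup F] [NormedSpace ℝ F]
    {γ : ℝ → E} {a b : ℝ} {K : ℝ≥0} (hγ : LipschitzOnWith K γ (Icc a b)) {G : E → F}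
    (hG : ContDiff ℝ 1 G) : ∃ L : ℝ≥0, LipschitzOnWith L (fun u => G (γ u)) (Icc a b) := by
  obtain ⟨r, hr⟩ := ((isCompact_Icc.image_of_continuousOn hγ.continuousOn).isBounded).subset_closedBall
    (0 : E)
  have : ProperSpace E := FiniteDimensional.proper ℝ E
  obtain ⟨L, hL⟩ := (hG.contDiffOn (s := closedBall (0 : E) r)).exists_lipschitzOnWith
    one_ne_zero (convex_closedBall 0 r) (isCompact_closedBall 0 r)
  exact ⟨L * K, hL.comp hγ fun u hu => hr ⟨u, hu, rfl⟩⟩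

theorem ae_differentiableAt_of_lipschitzOnWith {γ : ℝ → E} {a b : ℝ} {K : ℝ≥0}
    (hγ : LipschitzOnWith K γ (Icc a b)) : ∀ᵐ u, u ∈ Ioo a b → DifferentiableAt ℝ γ u := by
  filter_upwards [hγ.ae_differentiableWithinAt_of_mem_real] with u h hu
  exact (h (Ioo_subset_Icc_self hu)).differentiableAt (Icc_mem_nhds hu.1 hu.2)

theorem intervalIntegrable_mul_norm_deriv {γ : ℝ → E} {a b : ℝ} {K : ℝ≥0} (hab : a ≤ b)
    (hγ : LipschitzOnWith K γ (Icc a b)) {g : ℝ → ℝ} (hg : ContinuousOn g (Icc a b)) :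
    IntervalIntegrable (fun u => g u * ‖deriv γ u‖) volume a b := by
  rw [intervalIntegrable_iff_integrableOn_Ioo_of_le hab]
  have h1 : IntegrableOn (fun u => ‖deriv γ u‖) (Ioo a b) volume := by
    refine Measure.integrableOn_of_bounded (M := K) (by simp) ?_ ?_
    · exact (aestronglyMeasurable_deriv γ _).norm
    · refine ae_restrict_of_forall_mem measurableSet_Ioo fun u hu => ?_
      rw [norm_norm]; exact norm_deriv_le_of_lipschitzOn (Icc_mem_nhds hu.1 hu.2) hγ
  obtain ⟨C, hC⟩ := isCompact_Icc.exists_bound_of_continuousOn hg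
  refine h1.bdd_mul (c := C) ?_ ?_
  · exact (hg.mono Ioo_subset_Icc_self).aestronglyMeasurable measurableSet_Ioo
  · exact ae_restrict_of_forall_mem measurableSet_Ioo fun u hu => hC u (Ioo_subset_Icc_self hu)

theorem dist_le_integral_norm_deriv {γ : ℝ → E} {a b : ℝ} {K : ℝ≥0} (hab : a ≤ b)
    (hγ : LipschitzOnWith K γ (Icc a b)) : dist (γ a) (γ b) ≤ ∫ u in a..b, ‖deriv γ u‖ := by
  set e := γ b - γ a with he
  obtain ⟨L, hL⟩ := exists_lipschitzOnWith_comp hγ (G := fun x => inner ℝ e x)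
    (contDiff_const.inner ℝ contDiff_id)
  have hac : AbsolutelyContinuousOnInterval (fun u => inner ℝ e (γ u)) a b :=
    LipschitzOnWith.absolutelyContinuousOnInterval (by rwa [uIcc_of_le hab])
  have hint : IntervalIntegrable (fun u => ‖deriv γ u‖) volume a b := by
    simpa using intervalIntegrable_mul_norm_deriv hab hγ (g := fun _ => 1) continuousOn_const
  have h1 := hac.integral_deriv_eq_sub
  rw [← inner_sub_right, real_inner_self_eq_norm_sq] at h1
  have h2 : ∫ u in a..b, deriv (fun u => inner ℝ e (γ u)) u ≤ ∫ u in a..b, ‖e‖ * ‖deriv γ u‖ := by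
    refine integral_mono_of_ae_Ioo hab hac.intervalIntegrable_deriv (hint.const_mul _) ?_
    filter_upwards [ae_differentiableAt_of_lipschitzOnWith hγ] with u hu hu'
    have : HasDerivAt (fun u => inner ℝ e (γ u)) (inner ℝ e (deriv γ u)) u := by
      simpa using (hasDerivAt_const u e).inner ℝ (hu hu').hasDerivAt
    rw [this.deriv]
    exact real_inner_le_norm _ _
  rw [h1, intervalIntegral.integral_const_mul, sq] at h2
  rw [dist_comm, dist_eq_norm]
  rcases (norm_nonneg e).eq_or_lt with h0 | hpos
  · rw [← he, ← h0]
    exact intervalIntegral.integral_nonneg hab fun u _ => norm_nonneg _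
  · exact le_of_mul_le_mul_left h2 hpos

/-- A Lipschitz path that stays in the offset of unique projection projects to a Lipschitz path. -/
theorem lipschitzOnWith_proj {M : Set E} (hM : IsClosed M) (hne : M.Nonempty) {T h : ℝ}
    (hT : 0 < T) (hU : UniqueProjection M T) {x : ℝ → E} {a b : ℝ} {K : ℝ≥0}
    (hx : LipschitzOnWith K x (Icc a b)) (hh : h < T) (hxh : ∀ u ∈ Icc a b, infDist (x u) M ≤ h) :
    ∃ L : ℝ≥0, LipschitzOnWith L (fun u => proj M (x u)) (Icc a b) := by
  have : ProperSpace E := FiniteDimensional.proper ℝ E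
  have h1 : 0 < 1 - h / T := by rw [sub_pos, div_lt_one hT]; exact hh
  refine ⟨K / (1 - h / T).toNNReal, LipschitzOnWith.of_dist_le_mul fun u hu v hv => ?_⟩
  have h2 := dist_proj_le hM hne hT hU ((hxh u hu).trans_lt hh) ((hxh v hv).trans_lt hh)
  have h3 := hx.dist_le_mul u hu v hv
  rw [NNReal.coe_div, Real.coe_toNNReal _ h1.le, div_mul_eq_mul_div, le_div_iff₀ h1]
  refine le_trans ?_ (h2.trans h3)
  refine mul_le_mul_of_nonneg_left (sub_le_sub_left ?_ _) dist_nonneg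
  rw [div_le_div_iff₀ (by positivity) hT]
  nlinarith [hxh u hu, hxh v hv]

/-- The projection onto `M` increases the speed of a path at distance `d` from `M` at most by the
factor `1 / (1 - d / T)`. -/
theorem norm_deriv_proj_le {M : Set E} (hM : IsClosed M) (hne : M.Nonempty) {T : ℝ}
    (hT : 0 < T) (hU : UniqueProjection M T) {x : ℝ → E} {u : ℝ} (hxu : infDist (x u) M < T)
    (hx : DifferentiableAt ℝ x u) (hy : DifferentiableAt ℝ (fun u => proj M (x u)) u) :
    ‖deriv (fun u => proj M (x u)) u‖ * (1 - infDist (x u) M / T) ≤ ‖deriv x u‖ := by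
  have : ProperSpace E := FiniteDimensional.proper ℝ E
  have h1 := (hasDerivAt_iff_tendsto_slope.1 hx.hasDerivAt).norm
  have h2 := (hasDerivAt_iff_tendsto_slope.1 hy.hasDerivAt).norm
  have hc : Tendsto (fun v => infDist (x v) M) (𝓝 u) (𝓝 (infDist (x u) M)) :=
    ((continuous_infDist_pt M).continuousAt.comp hx.continuousAt).tendsto
  have h3 : Tendsto (fun v => 1 - (infDist (x v) M + infDist (x u) M) / (2 * T)) (𝓝[≠] u)
      (𝓝 (1 - infDist (x u) M / T)) := by
    have : 1 - infDist (x u) M / T = 1 - (infDist (x u) M + infDist (x u) M) / (2 * T) := by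
      field_simp; ring
    rw [this]
    exact (((hc.add_const _).div_const _).const_sub _).mono_left nhdsWithin_le_nhds
  refine le_of_tendsto_of_tendsto (h2.mul h3) h1 ?_
  have h4 : ∀ᶠ v in 𝓝[≠] u, infDist (x v) M < T :=
    nhdsWithin_le_nhds (hc.eventually (gt_mem_nhds hxu))
  filter_upwards [h4] with v hv
  have h5 := dist_proj_le hM hne hT hU hv hxu
  simp only [slope, vsub_eq_sub, norm_smul]
  rw [mul_assoc, ← dist_eq_norm, ← dist_eq_norm]
  gcongr

end LipschitzPath

/-! ### Arcs of minimizing geodesics -/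

section Geodesic

variable {N : ℕ}

theorem conformalLength_congr {f : EuclideanSpace ℝ (Fin N) → ℝ} {a b : ℝ} (hab : a ≤ b)
    {γ γ' : ℝ → EuclideanSpace ℝ (Fin N)} (h : EqOn γ γ' (Ioo a b)) :
    conformalLength f a b γ = conformalLength f a b γ' := by
  rw [conformalLength, conformalLength, intervalIntegral.integral_of_le hab,
    intervalIntegral.integral_of_le hab, integral_Ioc_eq_integral_Ioo,
    integral_Ioc_eq_integral_Ioo]
  refine setIntegral_congr_fun measurableSet_Ioo fun u hu => ?_
  have : γ =ᶠ[𝓝 u] γ' := h.eventuallyEq_of_mem (Ioo_mem_nhds hu.1 hu.2)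
  simp only [h hu, this.deriv_eq]

/-- An arc of a minimizing geodesic is not longer than any path `η` in `M` with the same endpoints:
`η` can be substituted for the arc. -/
theorem IsGeodesic.conformalLength_le {M : Set (EuclideanSpace ℝ (Fin N))}
    {f : EuclideanSpace ℝ (Fin N) → ℝ} (hfc : ContinuousOn f M) (hf : ∀ z ∈ M, 0 ≤ f z)
    {x y : EuclideanSpace ℝ (Fin N)} {a b s t : ℝ} {γ η : ℝ → EuclideanSpace ℝ (Fin N)}
    (hγ : IsGeodesic M f x y a b γ) (has : a ≤ s) (hst : s ≤ t) (htb : t ≤ b) {L : ℝ≥0}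
    (hη : LipschitzOnWith L η (Icc s t)) (hηM : MapsTo η (Icc s t) M) (hs : η s = γ s)
    (ht : η t = γ t) : conformalLength f s t γ ≤ conformalLength f s t η := by
  classical
  obtain ⟨K, hK⟩ := hγ.isPath.lipschitz
  set ζ : ℝ → EuclideanSpace ℝ (Fin N) := fun u => if u ∈ Icc s t then η u else γ u with hζ
  have e1 : EqOn ζ γ (Icc a s) := by
    intro u hu
    by_cases h : u ∈ Icc s t
    · have : u = s := le_antisymm hu.2 h.1
      simp [hζ, this, hs, hst]
    · simp only [hζ, if_neg h]
  have e2 : EqOn ζ η (Icc s t) := fun u hu => by simp only [hζ, if_pos hu]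
  have e3 : EqOn ζ γ (Icc t b) := by
    intro u hu
    by_cases h : u ∈ Icc s t
    · have : u = t := le_antisymm h.2 hu.1
      simp [hζ, this, ht, hst]
    · simp only [hζ, if_neg h]
  have m1 : Icc a s ⊆ Icc a b := Icc_subset_Icc_right (hst.trans htb)
  have m2 : Icc s t ⊆ Icc a b := Icc_subset_Icc has htb
  have m3 : Icc t b ⊆ Icc a b := Icc_subset_Icc_left (has.trans hst)
  have hζL : LipschitzOnWith (max K L) ζ (Icc a b) := by
    refine lipschitzOnWith_Icc_glue (c := s) ?_ (lipschitzOnWith_Icc_glue (c := t) ?_ ?_)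
    · exact fun u hu v hv => by
        rw [e1 hu, e1 hv]; exact ((hK.mono m1).weaken (le_max_left _ _)) hu hv
    · exact fun u hu v hv => by
        rw [e2 hu, e2 hv]; exact (hη.weaken (le_max_right _ _)) hu hv
    · exact fun u hu v hv => by
        rw [e3 hu, e3 hv]; exact ((hK.mono m3).weaken (le_max_left _ _)) hu hv
  have hζM : MapsTo ζ (Icc a b) M := by
    intro u hu
    by_cases h : u ∈ Icc s t
    · rw [e2 h]; exact hηM h
    · simp only [hζ, if_neg h]; exact hγ.isPath.mapsTo hu
  have hpath : IsLipschitzPath M x y a b ζ :=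
    ⟨hγ.isPath.lt, ⟨_, hζL⟩, hζM,
      by rw [e1 ⟨le_rfl, has⟩, hγ.isPath.source], by rw [e3 ⟨htb, le_rfl⟩, hγ.isPath.target]⟩
  have hle : conformalLength f a b γ ≤ conformalLength f a b ζ := by
    have h1 : conformalDist M f x y ≤ ENNReal.ofReal (conformalLength f a b ζ) :=
      iInf_le_of_le a <| iInf_le_of_le b <| iInf_le_of_le ζ <| iInf_le _ hpath
    rw [← hγ.minimizing, ENNReal.ofReal_le_ofReal_iff] at h1
    · exact h1
    · exact intervalIntegral.integral_nonneg hγ.isPath.lt.le fun u hu =>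
        mul_nonneg (hf _ (hζM hu)) (norm_nonneg _)
  have split : ∀ {θ : ℝ → EuclideanSpace ℝ (Fin N)} {C : ℝ≥0}, LipschitzOnWith C θ (Icc a b) →
      MapsTo θ (Icc a b) M → conformalLength f a b θ
        = conformalLength f a s θ + conformalLength f s t θ + conformalLength f t b θ := by
    intro θ C hθ hθM
    have hc : ContinuousOn (fun u => f (θ u)) (Icc a b) := hfc.comp hθ.continuousOn hθM
    have i1 := intervalIntegrable_mul_norm_deriv has (hθ.mono m1) (hc.mono m1)
    have i2 := intervalIntegrable_mul_norm_deriv hst (hθ.mono m2) (hc.mono m2)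
    have i3 := intervalIntegrable_mul_norm_deriv htb (hθ.mono m3) (hc.mono m3)
    simp only [conformalLength]
    rw [intervalIntegral.integral_add_adjacent_intervals i1 i2,
      intervalIntegral.integral_add_adjacent_intervals (i1.trans i2) i3]
  rw [split hK hγ.isPath.mapsTo, split hζL hζM,
    conformalLength_congr has (e1.mono Ioo_subset_Icc_self),
    conformalLength_congr hst (e2.mono Ioo_subset_Icc_self),
    conformalLength_congr htb (e3.mono Ioo_subset_Icc_self)] at hle
  linarith

end Geodesic

/-! ### Shortest paths are confined to a ball -/

section ShortestPath

variable {N : ℕ}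

/-- `γ : [s, t] → M` is Lipschitz and no Lipschitz path in `M` with the same endpoints,
parametrized by the same segment, has smaller conformal length. -/
structure IsShortest (M : Set (EuclideanSpace ℝ (Fin N))) (f : EuclideanSpace ℝ (Fin N) → ℝ)
    (s t : ℝ) (γ : ℝ → EuclideanSpace ℝ (Fin N)) : Prop where
  lt : s < t
  lipschitz : ∃ L : ℝ≥0, LipschitzOnWith L γ (Icc s t)
  mapsTo : MapsTo γ (Icc s t) M
  le : ∀ (η : ℝ → EuclideanSpace ℝ (Fin N)) (L : ℝ≥0), LipschitzOnWith L η (Icc s t) →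
    MapsTo η (Icc s t) M → η s = γ s → η t = γ t →
      conformalLength f s t γ ≤ conformalLength f s t η

variable {M : Set (EuclideanSpace ℝ (Fin N))} {f : EuclideanSpace ℝ (Fin N) → ℝ} {κ : ℝ≥0}
  {fmin T s t : ℝ} {γ : ℝ → EuclideanSpace ℝ (Fin N)}

/-- The length of a shortest path between two points of `M` at distance at most `T` is comparable
to their distance: the competitor is the projection of the segment onto `M`. -/
theorem IsShortest.integral_norm_deriv_le (hγ : IsShortest M f s t γ) (hM : IsClosed M)
    (hT : 0 < T) (hU : UniqueProjection M T) (hf : LipschitzOnWith κ f M) (hfmin : 0 < fmin)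
    (hf_lower : ∀ z ∈ M, fmin ≤ f z) (hκ : 4 * κ * T ≤ fmin) (hc : dist (γ s) (γ t) ≤ T) :
    ∫ u in s..t, ‖deriv γ u‖ ≤ 8 / 5 * dist (γ s) (γ t) := by
  have hst := hγ.lt
  have hsI : s ∈ Icc s t := left_mem_Icc.2 hst.le
  have htI : t ∈ Icc s t := right_mem_Icc.2 hst.le
  obtain ⟨K, hK⟩ := hγ.lipschitz
  have hpM := hγ.mapsTo hsI
  have hqM := hγ.mapsTo htI
  have hne : M.Nonempty := ⟨_, hpM⟩
  have hfc : ContinuousOn (fun u => f (γ u)) (Icc s t) :=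
    hf.continuousOn.comp hK.continuousOn hγ.mapsTo
  obtain ⟨m, hm, hmin⟩ := isCompact_Icc.exists_isMinOn ⟨s, hsI⟩ hfc
  -- The conformal factor is compared with its minimum `F` on the path, not with `fmin`.
  set F := f (γ m) with hF
  have hFmin : fmin ≤ F := hf_lower _ (hγ.mapsTo hm)
  set ℓ := ∫ u in s..t, ‖deriv γ u‖ with hℓ
  set p := γ s with hp
  set q := γ t with hq
  set c := dist p q with hcdef
  have hc0 : 0 ≤ c := dist_nonneg
  have hint1 : IntervalIntegrable (fun u => ‖deriv γ u‖) volume s t := by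
    simpa using intervalIntegrable_mul_norm_deriv hst.le hK (g := fun _ => 1) continuousOn_const
  have hlower : F * ℓ ≤ conformalLength f s t γ := by
    rw [hℓ, ← intervalIntegral.integral_const_mul]
    exact intervalIntegral.integral_mono_on hst.le (hint1.const_mul F)
      (intervalIntegrable_mul_norm_deriv hst.le hK hfc)
      fun u hu => mul_le_mul_of_nonneg_right (hmin hu) (norm_nonneg _)
  have hmℓ : dist p (γ m) + dist (γ m) q ≤ ℓ := by
    have i1 := dist_le_integral_norm_deriv hm.1 (hK.mono (Icc_subset_Icc_right hm.2))
    have i2 := dist_le_integral_norm_deriv hm.2 (hK.mono (Icc_subset_Icc_left hm.1))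
    have : ℓ = (∫ u in s..m, ‖deriv γ u‖) + ∫ u in m..t, ‖deriv γ u‖ :=
      (intervalIntegral.integral_add_adjacent_intervals
        (hint1.mono_set (by rw [uIcc_of_le hm.1, uIcc_of_le hst.le]; exact Icc_subset_Icc_right hm.2))
        (hint1.mono_set
          (by rw [uIcc_of_le hm.2, uIcc_of_le hst.le]; exact Icc_subset_Icc_left hm.1))).symm
    linarith
  set x : ℝ → EuclideanSpace ℝ (Fin N) := fun u => p + ((u - s) / (t - s)) • (q - p) with hx
  have hts : 0 < t - s := sub_pos.2 hst
  have hl : ∀ u ∈ Icc s t, (u - s) / (t - s) ∈ Icc (0 : ℝ) 1 := fun u hu =>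
    ⟨div_nonneg (by linarith [hu.1]) hts.le, (div_le_one hts).2 (by linarith [hu.2])⟩
  have hxd : ∀ u ∈ Icc s t, infDist (x u) M ≤ T / 7 := fun u hu =>
    infDist_segment_le hM hU hpM hqM hT hc (hl u hu)
  have hxderiv : ∀ u, HasDerivAt x ((t - s)⁻¹ • (q - p)) u := by
    intro u
    have := ((((hasDerivAt_id u).sub_const s).div_const (t - s)).smul_const (q - p)).const_add p
    simpa [hx] using this
  have hxs : x s = p := by simp [hx]
  have hxt : x t = q := by simp [hx, hts.ne']
  obtain ⟨L₀, hL₀⟩ : ∃ L₀ : ℝ≥0, LipschitzOnWith L₀ x (Icc s t) :=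
    ContDiffOn.exists_lipschitzOnWith (n := 1) (ContDiff.contDiffOn (by fun_prop)) one_ne_zero
      (convex_Icc s t) isCompact_Icc
  obtain ⟨L, hL⟩ := lipschitzOnWith_proj hM hne hT hU hL₀ (by linarith) hxd
  set η : ℝ → EuclideanSpace ℝ (Fin N) := fun u => proj M (x u) with hη
  have hηM : MapsTo η (Icc s t) M := fun u _ => proj_mem hM hne _
  have hηs : η s = p := by rw [hη]; simp only [hxs]; exact proj_eq_self hM hne hpM
  have hηt : η t = q := by rw [hη]; simp only [hxt]; exact proj_eq_self hM hne hqM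
  have hdist : ∀ u ∈ Icc s t, ∀ v ∈ Icc s t, dist (η u) (η v) ≤ 7 / 6 * dist (x u) (x v) := by
    intro u hu v hv
    have h1 := dist_proj_le hM hne hT hU (x := x u) (y := x v) (by linarith [hxd u hu])
      (by linarith [hxd v hv])
    have h2 : 6 / 7 ≤ 1 - (infDist (x u) M + infDist (x v) M) / (2 * T) := by
      rw [le_sub_comm, div_le_iff₀ (by positivity)]
      linarith [hxd u hu, hxd v hv]
    have := mul_le_mul_of_nonneg_left h2 (dist_nonneg (x := η u) (y := η v))
    linarith
  have hspeed : ∀ᵐ u, u ∈ Ioo s t → ‖deriv η u‖ ≤ 7 / 6 * c / (t - s) := by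
    filter_upwards [ae_differentiableAt_of_lipschitzOnWith hL] with u hu hu'
    have hu'' := Ioo_subset_Icc_self hu'
    have h1 := norm_deriv_proj_le hM hne hT hU (x := x) (u := u) (by linarith [hxd u hu''])
      (hxderiv u).differentiableAt (hu hu')
    rw [(hxderiv u).deriv, norm_smul, ← dist_eq_norm, dist_comm, norm_inv,
      Real.norm_of_nonneg hts.le, ← div_eq_inv_mul] at h1
    have h2 : 6 / 7 ≤ 1 - infDist (x u) M / T := by
      rw [le_sub_comm, div_le_iff₀ hT]
      linarith [hxd u hu'']
    have h3 := mul_le_mul_of_nonneg_left h2 (norm_nonneg (deriv η u))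
    have : 7 / 6 * c / (t - s) = 7 / 6 * (c / (t - s)) := by ring
    linarith
  have hfη : ∀ u ∈ Icc s t, f (η u) ≤ F + κ * ((7 / 6 * c + ℓ) / 2) := by
    intro u hu
    have h1 : f (η u) - F ≤ κ * dist (η u) (γ m) := by
      have := hf.dist_le_mul _ (hηM hu) _ (hγ.mapsTo hm)
      exact (le_abs_self _).trans this
    -- The two triangle inequalities through `p` and through `q` are averaged.
    have h2 : dist (η u) (γ m) ≤ (7 / 6 * c + ℓ) / 2 := by
      have a1 := hdist u hu s hsI
      have a2 := hdist u hu t htI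
      have a3 := dist_triangle (η u) p (γ m)
      have a4 := dist_triangle (η u) q (γ m)
      have hlu := hl u hu
      have b1 : dist (x u) p = (u - s) / (t - s) * c := by
        rw [hx, dist_eq_norm]; simp only
        rw [add_sub_cancel_left, norm_smul, Real.norm_of_nonneg hlu.1, ← dist_eq_norm, dist_comm]
      have b2 : dist (x u) q = (1 - (u - s) / (t - s)) * c := by
        rw [hx, dist_eq_norm]; simp only
        rw [show p + ((u - s) / (t - s)) • (q - p) - q = (1 - (u - s) / (t - s)) • (p - q) by
          module, norm_smul, Real.norm_of_nonneg (by linarith [hlu.2]), ← dist_eq_norm]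
      rw [hηs, hxs, b1] at a1
      rw [hηt, hxt, b2] at a2
      rw [dist_comm q] at a4
      linarith
    have := mul_le_mul_of_nonneg_left h2 κ.coe_nonneg
    linarith
  have hupper : conformalLength f s t η
      ≤ (F + κ * ((7 / 6 * c + ℓ) / 2)) * (7 / 6 * c) := by
    have hfηc : ContinuousOn (fun u => f (η u)) (Icc s t) :=
      hf.continuousOn.comp hL.continuousOn hηM
    have : (F + κ * ((7 / 6 * c + ℓ) / 2)) * (7 / 6 * c)
        = ∫ _ in s..t, (F + κ * ((7 / 6 * c + ℓ) / 2)) * (7 / 6 * c / (t - s)) := by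
      rw [intervalIntegral.integral_const, smul_eq_mul]
      field_simp
    rw [this]
    refine integral_mono_of_ae_Ioo hst.le (intervalIntegrable_mul_norm_deriv hst.le hL hfηc)
      (by simp) ?_
    filter_upwards [hspeed] with u hu hu'
    have h1 := hfη u (Ioo_subset_Icc_self hu')
    have h2 : 0 ≤ f (η u) := hfmin.le.trans (hf_lower _ (hηM (Ioo_subset_Icc_self hu')))
    exact mul_le_mul h1 (hu hu') (norm_nonneg _) (h2.trans h1)
  have hfinal := hlower.trans ((hγ.le η L hL hηM hηs hηt).trans hupper)
  have hκc : 4 * (κ * c) ≤ F := by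
    have := mul_le_mul_of_nonneg_left hc κ.coe_nonneg
    linarith
  have hℓ0 : 0 ≤ ℓ := intervalIntegral.integral_nonneg hst.le fun u _ => norm_nonneg _
  have hF0 : 0 < F := hfmin.trans_le hFmin
  refine le_of_mul_le_mul_left ?_ hF0
  -- `hfinal` and `4 κ c ≤ F` give `ℓ ≤ 385 / 246 * c`.
  nlinarith [mul_le_mul_of_nonneg_right hκc hc0, mul_le_mul_of_nonneg_right hκc hℓ0,
    mul_nonneg hF0.le hc0]

/-- A shortest path between two points of a sphere of radius `r` stays in the concentric ball of
radius `8 / 5 * r`, by Ptolemy's inequality. -/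
theorem IsShortest.dist_le (hγ : IsShortest M f s t γ) (hM : IsClosed M)
    (hT : 0 < T) (hU : UniqueProjection M T) (hf : LipschitzOnWith κ f M) (hfmin : 0 < fmin)
    (hf_lower : ∀ z ∈ M, fmin ≤ f z) (hκ : 4 * κ * T ≤ fmin) {z : EuclideanSpace ℝ (Fin N)}
    {r : ℝ} (hrT : 2 * r ≤ T) (hs : dist z (γ s) = r) (ht : dist z (γ t) = r)
    (hne : γ s ≠ γ t) {u : ℝ} (hu : u ∈ Icc s t) : dist (γ u) z ≤ 8 / 5 * r := by
  have hc : dist (γ s) (γ t) ≤ T := by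
    have := dist_triangle_left (γ s) (γ t) z
    linarith
  have hℓ := hγ.integral_norm_deriv_le hM hT hU hf hfmin hf_lower hκ hc
  obtain ⟨K, hK⟩ := hγ.lipschitz
  have hint1 : IntervalIntegrable (fun u => ‖deriv γ u‖) volume s t := by
    simpa using
      intervalIntegrable_mul_norm_deriv hγ.lt.le hK (g := fun _ => 1) continuousOn_const
  have i1 := dist_le_integral_norm_deriv hu.1 (hK.mono (Icc_subset_Icc_right hu.2))
  have i2 := dist_le_integral_norm_deriv hu.2 (hK.mono (Icc_subset_Icc_left hu.1))
  have i3 := intervalIntegral.integral_add_adjacent_intervals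
    (hint1.mono_set
      (by rw [uIcc_of_le hu.1, uIcc_of_le hγ.lt.le]; exact Icc_subset_Icc_right hu.2))
    (hint1.mono_set
      (by rw [uIcc_of_le hu.2, uIcc_of_le hγ.lt.le]; exact Icc_subset_Icc_left hu.1))
  have hpt := EuclideanGeometry.mul_dist_le_mul_dist_add_mul_dist (γ u) (γ s) z (γ t)
  rw [dist_comm (γ s) z, hs, ht, dist_comm (γ u) (γ s)] at hpt
  have hr : 0 ≤ r := hs ▸ dist_nonneg
  refine le_of_mul_le_mul_right ?_ (dist_pos.2 hne)
  nlinarith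

end ShortestPath

/-! ### The variation of a path towards a point -/

section Variation

/-- The velocity `(1 - a) v - b w` of a variation, where `v` is the velocity of the path, `w` its
position relative to the centre, and `b`, `⟪v, w⟫` have the same sign: the terms of first order in
`b` do not increase the norm. -/
theorem norm_smul_sub_smul_le {E : Type*} [NormedAddCommGroup E] [InnerProductSpace ℝ E]
    {v w : E} {a b β D : ℝ} (ha : a ≤ 1 / 2) (hb : 0 ≤ b * inner ℝ v w)
    (hbv : |b| ≤ β * ‖v‖) (hw : ‖w‖ ≤ D) :
    ‖(1 - a) • v - b • w‖ ≤ (1 - a + β ^ 2 * D ^ 2) * ‖v‖ := by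
  have hD : 0 ≤ D := (norm_nonneg w).trans hw
  have h1 : 0 ≤ β ^ 2 * D ^ 2 := by positivity
  refine (abs_le_of_sq_le_sq' ?_ (mul_nonneg (by linarith) (norm_nonneg v))).2
  rw [norm_sub_sq_real, norm_smul, norm_smul, inner_smul_left, inner_smul_right,
    Real.norm_of_nonneg (by linarith), Real.norm_eq_abs, mul_pow, mul_pow]
  simp only [conj_trivial]
  have h2 : |b| ^ 2 * ‖w‖ ^ 2 ≤ (β * ‖v‖) ^ 2 * D ^ 2 := by gcongr
  have h3 : 0 ≤ (1 - a) * (b * inner ℝ v w) := mul_nonneg (by linarith) hb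
  have h4 : 0 ≤ (1 - 2 * a) * (β ^ 2 * D ^ 2) * ‖v‖ ^ 2 :=
    mul_nonneg (mul_nonneg (by linarith) h1) (sq_nonneg _)
  nlinarith [mul_nonneg (sq_nonneg (β ^ 2 * D ^ 2)) (sq_nonneg ‖v‖)]

/-- The expansion to first order in `ε` of the factor by which the conformal length element
changes: a point at distance at most `D` from the centre is displaced by `w`, at most the fraction
`ε φ` of that distance, and `D * (k + 1 / T) ≤ 1` makes the first-order term nonpositive. -/
theorem variation_factor_le {k T D B C ε φ w : ℝ} (hk : 0 ≤ k) (hT : 0 < T) (hD : 0 ≤ D)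
    (hC : 0 ≤ C) (hφ0 : 0 ≤ φ) (hφB : φ ≤ B) (hε : 0 ≤ ε) (hw0 : 0 ≤ w)
    (hw : w ≤ ε * φ * D) (hwT : w ≤ T / 2)
    (hDk : D * (k + 1 / T) ≤ 1) :
    (1 + k * (w * (1 + w / T))) * (1 - ε * φ + ε ^ 2 * C) ≤
      (1 - (1 - D * (k + 1 / T)) * (ε * φ)
        + 2 * (C + k * B ^ 2 * D ^ 2 / T + k * T * C) * ε ^ 2) * (1 - w / T) := by
  set a := ε * φ with ha
  have ha0 : 0 ≤ a := by positivity
  have haB : a ≤ ε * B := by rw [ha]; gcongr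
  have hB : 0 ≤ B := hφ0.trans hφB
  obtain ⟨y, hy⟩ : ∃ y, y = w / T := ⟨_, rfl⟩
  have hwy : w = T * y := by rw [hy]; field_simp
  have hy0 : 0 ≤ y := by rw [hy]; positivity
  have hy2 : y ≤ 1 / 2 := by rw [hy, div_le_iff₀ hT]; linarith
  rw [← hy]
  have hε2 : 0 ≤ ε ^ 2 := sq_nonneg _
  have e1 : k * (w * y) ≤ k * B ^ 2 * D ^ 2 / T * ε ^ 2 := by
    have : w * y = w ^ 2 / T := by rw [hy]; ring
    rw [this]
    have h1 : w ≤ ε * B * D := hw.trans (by gcongr)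
    calc k * (w ^ 2 / T) ≤ k * ((ε * B * D) ^ 2 / T) := by gcongr
      _ = _ := by ring
  have e2 : k * (w * (1 + y)) ≤ k * T := by
    gcongr
    nlinarith
  have e3 : k * w + y ≤ a * (D * (k + 1 / T)) := by
    have h1 : w * (k + 1 / T) ≤ a * D * (k + 1 / T) := by gcongr
    have h2 : w * (k + 1 / T) = k * w + y := by rw [hy]; ring
    linarith
  have e4 : 0 ≤ k * (w * (1 + y)) := by positivity
  set Q := k * B ^ 2 * D ^ 2 / T with hQ
  have hQ0 : 0 ≤ Q := by positivity
  set P := C + Q + k * T * C with hP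
  have hP0 : 0 ≤ P := by positivity
  have e5 : (1 + k * (w * (1 + y))) * (1 - a + ε ^ 2 * C)
      ≤ 1 - a + k * w + P * ε ^ 2 := by
    have h1 : k * (w * (1 + y)) * (ε ^ 2 * C) ≤ k * T * (ε ^ 2 * C) := by gcongr
    have h2 : 0 ≤ k * (w * (1 + y)) * a := mul_nonneg e4 ha0
    nlinarith
  have e6 : (1 - a + k * w + P * ε ^ 2)
      ≤ (1 - (1 - D * (k + 1 / T)) * a + 2 * P * ε ^ 2) * (1 - y) := by
    have h1 : 0 ≤ P * ε ^ 2 * (1 - 2 * y) := by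
      apply mul_nonneg (by positivity); linarith
    nlinarith [mul_nonneg (mul_nonneg (sub_nonneg.2 hDk) ha0) hy0]
  exact e5.trans e6

variable {N : ℕ} {M : Set (EuclideanSpace ℝ (Fin N))} {f : EuclideanSpace ℝ (Fin N) → ℝ} {κ : ℝ≥0}
  {fmin T s t : ℝ} {γ : ℝ → EuclideanSpace ℝ (Fin N)}

/-- The conformal length element of the projection to `M` of the variation
`x = γ - ε Φ(γ) (γ - z)` of `γ`. -/
theorem mul_norm_deriv_proj_variation_le (hM : IsClosed M) (hT : 0 < T)
    (hU : UniqueProjection M T) (hf : LipschitzOnWith κ f M) (hfmin : 0 < fmin)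
    (hf_lower : ∀ z ∈ M, fmin ≤ f z) {z : EuclideanSpace ℝ (Fin N)}
    {φ : ℝ → ℝ} {u A B D ε : ℝ} (hγM : γ u ∈ M) (hφ0 : 0 ≤ φ u) (hφB : φ u ≤ B)
    (hγ : DifferentiableAt ℝ γ u) (hφ : DifferentiableAt ℝ φ u)
    (hmono : 0 ≤ deriv φ u * inner ℝ (deriv γ u) (γ u - z))
    (hφA : |deriv φ u| ≤ A * ‖deriv γ u‖) (hDz : dist (γ u) z ≤ D)
    (hD : D * (κ / fmin + 1 / T) < 1) (hε : 0 ≤ ε) (hεB : ε * B ≤ 1 / 2)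
    (hεBD : ε * B * D ≤ T / 2)
    (hy : DifferentiableAt ℝ (fun v => proj M (γ v - (ε * φ v) • (γ v - z))) u) :
    f (proj M (γ u - (ε * φ u) • (γ u - z)))
        * ‖deriv (fun v => proj M (γ v - (ε * φ v) • (γ v - z))) u‖ ≤
      (1 - (1 - D * (κ / fmin + 1 / T)) * (ε * φ u)
        + 2 * (A ^ 2 * D ^ 2 + κ / fmin * B ^ 2 * D ^ 2 / T + κ / fmin * T * (A ^ 2 * D ^ 2))
          * ε ^ 2) * (f (γ u) * ‖deriv γ u‖) := by
  have hne : M.Nonempty := ⟨_, hγM⟩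
  set x : ℝ → EuclideanSpace ℝ (Fin N) := fun v => γ v - (ε * φ v) • (γ v - z) with hx
  set w := dist (x u) (γ u) with hw
  have hD0 : 0 ≤ D := dist_nonneg.trans hDz
  have hB0 : 0 ≤ B := hφ0.trans hφB
  have hw0 : 0 ≤ w := dist_nonneg
  have hwD : w ≤ ε * φ u * D := by
    rw [hw, hx, dist_eq_norm]
    simp only
    rw [sub_sub_cancel_left, norm_neg, norm_smul, Real.norm_of_nonneg (by positivity),
      ← dist_eq_norm]
    gcongr
  have hwT : w ≤ T / 2 := hwD.trans (le_trans (by gcongr) hεBD)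
  set d := infDist (x u) M with hd
  have hdw : d ≤ w := infDist_le_dist_of_mem hγM
  have hdT : d < T := by linarith
  have hFγ : fmin ≤ f (γ u) := hf_lower _ hγM
  have hF0 : 0 < f (γ u) := hfmin.trans_le hFγ
  set y := proj M (x u) with hydef
  have hyM : y ∈ M := proj_mem hM hne _
  have hwT1 : w / T ≤ 1 / 2 := by rw [div_le_iff₀ hT]; linarith
  have hwT0 : 0 ≤ w / T := by positivity
  -- A factor `1 + O(w)` is needed here: the triangle inequality would only give `2 * w`.
  have h1 : dist y (γ u) ≤ w * (1 + w / T) := by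
    have h := dist_proj_le hM hne hT hU (x := x u) (y := γ u) hdT
      (by rw [infDist_zero_of_mem hγM]; exact hT)
    rw [proj_eq_self hM hne hγM, infDist_zero_of_mem hγM, add_zero] at h
    have h2 : 1 - w / T / 2 ≤ 1 - d / (2 * T) := by
      rw [div_div, mul_comm T]
      gcongr
    have h3 := mul_le_mul_of_nonneg_left h2 (dist_nonneg (x := y) (y := γ u))
    have h4 : dist y (γ u) * (1 - w / T / 2) ≤ w := h3.trans h
    have h5 : 1 ≤ (1 - w / T / 2) * (1 + w / T) := by nlinarith
    nlinarith [mul_le_mul_of_nonneg_right h4 (by linarith : 0 ≤ 1 + w / T),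
      mul_le_mul_of_nonneg_left h5 (dist_nonneg (x := y) (y := γ u))]
  have hfy : f y ≤ f (γ u) * (1 + κ / fmin * (w * (1 + w / T))) := by
    have h2 : f y - f (γ u) ≤ κ * dist y (γ u) :=
      (le_abs_self _).trans (hf.dist_le_mul _ hyM _ hγM)
    have h3 : κ * dist y (γ u) ≤ κ * (w * (1 + w / T)) := by gcongr
    have h4 : (κ : ℝ) ≤ f (γ u) * (κ / fmin) := by
      rw [mul_div_assoc', le_div_iff₀ hfmin, mul_comm]
      gcongr
    have h5 : 0 ≤ w * (1 + w / T) := by positivity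
    nlinarith [mul_le_mul_of_nonneg_right h4 h5]
  have hxd : HasDerivAt x ((1 - ε * φ u) • deriv γ u - (ε * deriv φ u) • (γ u - z)) u := by
    have h2 := hγ.hasDerivAt.sub
      ((hφ.hasDerivAt.const_mul ε).smul (hγ.hasDerivAt.sub_const z))
    convert! h2 using 1
    module
  have hspeed : ‖deriv x u‖ ≤ (1 - ε * φ u + ε ^ 2 * (A ^ 2 * D ^ 2)) * ‖deriv γ u‖ := by
    rw [hxd.deriv]
    have := norm_smul_sub_smul_le (v := deriv γ u) (w := γ u - z) (a := ε * φ u)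
      (b := ε * deriv φ u) (β := ε * A) (D := D)
      (le_trans (by gcongr) hεB) (by rw [mul_assoc]; exact mul_nonneg hε hmono)
      (by rw [abs_mul, abs_of_nonneg hε, mul_assoc]; gcongr) (by rwa [← dist_eq_norm])
    rwa [mul_pow, mul_assoc] at this
  have hproj := norm_deriv_proj_le hM hne hT hU (x := x) hdT hxd.differentiableAt hy
  have hS := variation_factor_le (k := κ / fmin) (C := A ^ 2 * D ^ 2) (by positivity) hT hD0
    (by positivity) hφ0 hφB hε hw0 hwD hwT hD.le
  set S := 1 - (1 - D * (κ / fmin + 1 / T)) * (ε * φ u)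
        + 2 * (A ^ 2 * D ^ 2 + κ / fmin * B ^ 2 * D ^ 2 / T + κ / fmin * T * (A ^ 2 * D ^ 2))
          * ε ^ 2 with hSdef
  set ny := ‖deriv (fun v => proj M (x v)) u‖ with hny
  have hny0 : 0 ≤ ny := norm_nonneg _
  have hw1 : 0 < 1 - w / T := by linarith
  have hny1 : ny * (1 - w / T) ≤ (1 - ε * φ u + ε ^ 2 * (A ^ 2 * D ^ 2)) * ‖deriv γ u‖ := by
    refine le_trans ?_ (hproj.trans hspeed)
    gcongr
  refine le_of_mul_le_mul_right ?_ hw1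
  have hfy0 : 0 ≤ f y := hfmin.le.trans (hf_lower _ hyM)
  calc f y * ny * (1 - w / T) = f y * (ny * (1 - w / T)) := by ring
    _ ≤ (f (γ u) * (1 + κ / fmin * (w * (1 + w / T))))
        * ((1 - ε * φ u + ε ^ 2 * (A ^ 2 * D ^ 2)) * ‖deriv γ u‖) :=
      mul_le_mul hfy hny1 (mul_nonneg hny0 hw1.le) (hfy0.trans hfy)
    _ = (f (γ u) * ‖deriv γ u‖) * ((1 + κ / fmin * (w * (1 + w / T)))
        * (1 - ε * φ u + ε ^ 2 * (A ^ 2 * D ^ 2))) := by ring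
    _ ≤ (f (γ u) * ‖deriv γ u‖) * (S * (1 - w / T)) := by gcongr
    _ = S * (f (γ u) * ‖deriv γ u‖) * (1 - w / T) := by ring

end Variation

/-! ### Shortest paths admit no variation towards a nearby point -/

section Vanishing

variable {N : ℕ} {M : Set (EuclideanSpace ℝ (Fin N))} {f : EuclideanSpace ℝ (Fin N) → ℝ} {κ : ℝ≥0}
  {fmin T s t : ℝ} {γ : ℝ → EuclideanSpace ℝ (Fin N)}

/-- A shortest path close to `z` cannot be shortened by moving its points towards `z`: if the
amount `Φ ∘ γ` of the displacement is nonnegative, vanishes at the endpoints, and increases where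
the distance to `z` does, it vanishes identically. -/
theorem IsShortest.eq_zero_of_monotone (hγ : IsShortest M f s t γ) (hM : IsClosed M)
    (hT : 0 < T) (hU : UniqueProjection M T) (hf : LipschitzOnWith κ f M) (hfmin : 0 < fmin)
    (hf_lower : ∀ z ∈ M, fmin ≤ f z) {z : EuclideanSpace ℝ (Fin N)} {D : ℝ}
    (hDz : ∀ u ∈ Icc s t, dist (γ u) z ≤ D) (hD : D * (κ / fmin + 1 / T) < 1)
    {Φ : EuclideanSpace ℝ (Fin N) → ℝ} (hΦ : ContDiff ℝ 1 Φ)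
    (hΦ0 : ∀ u ∈ Icc s t, 0 ≤ Φ (γ u)) (hΦs : Φ (γ s) = 0) (hΦt : Φ (γ t) = 0)
    (hmono : ∀ u ∈ Ioo s t, DifferentiableAt ℝ γ u →
      0 ≤ deriv (fun v => Φ (γ v)) u * inner ℝ (deriv γ u) (γ u - z)) :
    ∀ u ∈ Icc s t, Φ (γ u) = 0 := by
  have hst := hγ.lt
  have hsI : s ∈ Icc s t := left_mem_Icc.2 hst.le
  have htI : t ∈ Icc s t := right_mem_Icc.2 hst.le
  obtain ⟨K, hK⟩ := hγ.lipschitz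
  have hne : M.Nonempty := ⟨_, hγ.mapsTo hsI⟩
  have hfc : ContinuousOn (fun u => f (γ u)) (Icc s t) :=
    hf.continuousOn.comp hK.continuousOn hγ.mapsTo
  set φ : ℝ → ℝ := fun v => Φ (γ v) with hφ
  have hφc : ContinuousOn φ (Icc s t) := hΦ.continuous.comp_continuousOn hK.continuousOn
  obtain ⟨B, hB⟩ := isCompact_Icc.exists_bound_of_continuousOn hφc
  have hφB : ∀ u ∈ Icc s t, φ u ≤ B := fun u hu => (le_abs_self _).trans (hB u hu)
  have hB0 : 0 ≤ B := (norm_nonneg _).trans (hB s hsI)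
  have hD0 : 0 ≤ D := dist_nonneg.trans (hDz s hsI)
  obtain ⟨A, hA⟩ := isCompact_Icc.exists_bound_of_continuousOn
    ((hΦ.continuous_fderiv one_ne_zero).comp_continuousOn hK.continuousOn)
  have hφdiff : ∀ u, DifferentiableAt ℝ γ u → DifferentiableAt ℝ φ u := fun u hu =>
    ((hΦ.differentiable one_ne_zero).differentiableAt).comp u hu
  have hφA : ∀ u ∈ Icc s t, DifferentiableAt ℝ γ u → |deriv φ u| ≤ A * ‖deriv γ u‖ := by
    intro u hu hd
    have h1 : HasDerivAt φ (fderiv ℝ Φ (γ u) (deriv γ u)) u :=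
      ((hΦ.differentiable one_ne_zero) (γ u)).hasFDerivAt.comp_hasDerivAt u hd.hasDerivAt
    rw [h1.deriv]
    exact ((fderiv ℝ Φ (γ u)).le_opNorm _).trans
      (mul_le_mul_of_nonneg_right (hA u hu) (norm_nonneg _))
  set θ := 1 - D * (κ / fmin + 1 / T) with hθ
  have hθ0 : 0 < θ := sub_pos.2 hD
  set C := 2 * (A ^ 2 * D ^ 2 + κ / fmin * B ^ 2 * D ^ 2 / T + κ / fmin * T * (A ^ 2 * D ^ 2))
    with hC
  have hI0 := intervalIntegrable_mul_norm_deriv hst.le hK hfc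
  have hI1 : IntervalIntegrable (fun u => f (γ u) * φ u * ‖deriv γ u‖) volume s t :=
    intervalIntegrable_mul_norm_deriv hst.le hK (hfc.mul hφc)
  set I := ∫ u in s..t, f (γ u) * φ u * ‖deriv γ u‖ with hI
  set J := conformalLength f s t γ with hJ
  set ε₀ := min (1 / (2 * (B + 1))) (T / (2 * ((B + 1) * (D + 1)))) with hε₀
  have hε₀0 : 0 < ε₀ := by positivity
  -- Minimality against the variation of size `ε`, whose conformal length is at most
  -- `J - θ ε I + C ε ^ 2 J`.
  have key : ∀ ε, 0 < ε → ε ≤ ε₀ → θ * I ≤ C * ε * J := by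
    intro ε hε hεε
    have hεB : ε * B ≤ 1 / 2 := by
      calc ε * B ≤ 1 / (2 * (B + 1)) * (B + 1) := by
            gcongr
            · exact hεε.trans (min_le_left _ _)
            · linarith
        _ = 1 / 2 := by field_simp
    have hεBD : ε * B * D ≤ T / 2 := by
      calc ε * B * D ≤ T / (2 * ((B + 1) * (D + 1))) * (B + 1) * (D + 1) := by
            gcongr
            · exact hεε.trans (min_le_right _ _)
            · linarith
            · linarith
        _ = T / 2 := by field_simp
    set x : ℝ → EuclideanSpace ℝ (Fin N) := fun v => γ v - (ε * φ v) • (γ v - z) with hx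
    obtain ⟨L₀, hL₀⟩ := exists_lipschitzOnWith_comp hK
      (G := fun v => v - (ε * Φ v) • (v - z)) (by fun_prop)
    have hxd : ∀ u ∈ Icc s t, infDist (x u) M ≤ T / 2 := by
      intro u hu
      refine (infDist_le_dist_of_mem (hγ.mapsTo hu)).trans (le_trans ?_ hεBD)
      rw [hx, dist_eq_norm]
      simp only
      have h0 := hΦ0 u hu
      rw [sub_sub_cancel_left, norm_neg, norm_smul, Real.norm_of_nonneg (by positivity),
        ← dist_eq_norm]
      have h1 := hφB u hu
      have h2 := hDz u hu
      gcongr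
    obtain ⟨L, hL⟩ := lipschitzOnWith_proj hM hne hT hU hL₀ (by linarith) hxd
    set y : ℝ → EuclideanSpace ℝ (Fin N) := fun v => proj M (x v) with hy
    have hyM : MapsTo y (Icc s t) M := fun u _ => proj_mem hM hne _
    have hys : y s = γ s := by
      simp only [hy, hx, hφ, hΦs, mul_zero, zero_smul, sub_zero]
      exact proj_eq_self hM hne (hγ.mapsTo hsI)
    have hyt : y t = γ t := by
      simp only [hy, hx, hφ, hΦt, mul_zero, zero_smul, sub_zero]
      exact proj_eq_self hM hne (hγ.mapsTo htI)
    have hfyc : ContinuousOn (fun u => f (y u)) (Icc s t) :=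
      hf.continuousOn.comp hL.continuousOn hyM
    have h1 : conformalLength f s t y ≤ J - θ * ε * I + C * ε ^ 2 * J := by
      have e : J - θ * ε * I + C * ε ^ 2 * J = ∫ u in s..t, (f (γ u) * ‖deriv γ u‖
          - θ * ε * (f (γ u) * φ u * ‖deriv γ u‖) + C * ε ^ 2 * (f (γ u) * ‖deriv γ u‖)) := by
        rw [intervalIntegral.integral_add (hI0.sub (hI1.const_mul _)) (hI0.const_mul _),
          intervalIntegral.integral_sub hI0 (hI1.const_mul _),
          intervalIntegral.integral_const_mul, intervalIntegral.integral_const_mul]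
        rfl
      rw [e]
      refine integral_mono_of_ae_Ioo hst.le (intervalIntegrable_mul_norm_deriv hst.le hL hfyc)
        ((hI0.sub (hI1.const_mul _)).add (hI0.const_mul _)) ?_
      filter_upwards [ae_differentiableAt_of_lipschitzOnWith hK,
        ae_differentiableAt_of_lipschitzOnWith hL] with u hu1 hu2 hu
      have hu' := Ioo_subset_Icc_self hu
      have h := mul_norm_deriv_proj_variation_le hM hT hU hf hfmin hf_lower (z := z) (φ := φ)
        (A := A) (B := B) (D := D) (ε := ε) (hγ.mapsTo hu') (hΦ0 u hu') (hφB u hu') (hu1 hu)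
        (hφdiff u (hu1 hu)) (hmono u hu (hu1 hu)) (hφA u hu' (hu1 hu)) (hDz u hu') hD hε.le
        hεB hεBD (hu2 hu)
      refine h.trans (le_of_eq ?_)
      ring
    have h2 := (hγ.le y L hL hyM hys hyt).trans h1
    have h3 : ε * (θ * I) ≤ ε * (C * ε * J) := by linarith
    exact le_of_mul_le_mul_left h3 hε
  have hI_le : θ * I ≤ 0 := by
    have hlim : Tendsto (fun ε : ℝ => C * ε * J) (𝓝[>] 0) (𝓝 0) := by
      have : Tendsto (fun ε : ℝ => C * ε * J) (𝓝 0) (𝓝 (C * 0 * J)) :=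
        Continuous.tendsto (by fun_prop) 0
      rw [mul_zero, zero_mul] at this
      exact this.mono_left nhdsWithin_le_nhds
    refine ge_of_tendsto hlim ?_
    filter_upwards [Ioc_mem_nhdsGT hε₀0] with ε hε using key ε hε.1 hε.2
  have hpos : ∀ u ∈ Icc s t, 0 ≤ f (γ u) * φ u * ‖deriv γ u‖ := fun u hu =>
    mul_nonneg (mul_nonneg (hfmin.le.trans (hf_lower _ (hγ.mapsTo hu))) (hΦ0 u hu)) (norm_nonneg _)
  have hIz : I = 0 := le_antisymm (by nlinarith) (intervalIntegral.integral_nonneg hst.le hpos)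
  have hae : ∀ᵐ u, u ∈ Ioc s t → f (γ u) * φ u * ‖deriv γ u‖ = 0 := by
    rw [hI, intervalIntegral.integral_eq_zero_iff_of_le_of_nonneg_ae hst.le
      (ae_restrict_of_forall_mem measurableSet_Ioc fun u hu => hpos u (Ioc_subset_Icc_self hu))
      hI1] at hIz
    exact (ae_restrict_iff' measurableSet_Ioc).1 hIz
  -- As `φ ‖γ'‖ = 0` almost everywhere and `|φ'| ≤ A ‖γ'‖`, the function `φ ^ 2` is constant.
  obtain ⟨L, hL⟩ := exists_lipschitzOnWith_comp hK (G := fun v => Φ v ^ 2) (by fun_prop)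
  have hac : AbsolutelyContinuousOnInterval (fun u => φ u ^ 2) s t :=
    LipschitzOnWith.absolutelyContinuousOnInterval (by rwa [uIcc_of_le hst.le])
  obtain ⟨c, hc⟩ := hac.const_of_ae_hasDerivAt_zero (by
    have n1 : ∀ᵐ u : ℝ, u ≠ s := by simp [ae_iff, measure_singleton]
    have n2 : ∀ᵐ u : ℝ, u ≠ t := by simp [ae_iff, measure_singleton]
    filter_upwards [hae, n1, n2, ae_differentiableAt_of_lipschitzOnWith hK] with u h1 h2 h3 h4 hu
    rw [uIcc_of_le hst.le] at hu
    have hu' : u ∈ Ioo s t := ⟨lt_of_le_of_ne hu.1 h2.symm, lt_of_le_of_ne hu.2 h3⟩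
    have hd := h4 hu'
    have h5 := (hφdiff u hd).hasDerivAt.pow 2
    have h6 : φ u * deriv φ u = 0 := by
      have hfpos : 0 < f (γ u) := hfmin.trans_le (hf_lower _ (hγ.mapsTo hu))
      rcases mul_eq_zero.1 (h1 (Ioo_subset_Ioc_self hu')) with h | h
      · rw [(mul_eq_zero.1 h).resolve_left hfpos.ne', zero_mul]
      · have := hφA u hu hd
        rw [h, mul_zero] at this
        rw [abs_eq_zero.1 (le_antisymm this (abs_nonneg _)), mul_zero]
    convert! h5 using 1
    rw [show ((2 : ℕ) : ℝ) * φ u ^ (2 - 1) * deriv φ u = 2 * (φ u * deriv φ u) by norm_num; ring,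
      h6, mul_zero])
  rw [uIcc_of_le hst.le] at hc
  have hc0 : c = 0 := by rw [← hc s hsI]; simp [hφ, hΦs]
  intro u hu
  have := hc u hu
  rw [hc0] at this
  exact pow_eq_zero_iff two_ne_zero |>.1 this

end Vanishing

/-! ### The reach of a minimizing geodesic -/

section Reach

variable {N : ℕ} {M : Set (EuclideanSpace ℝ (Fin N))} {f : EuclideanSpace ℝ (Fin N) → ℝ} {κ : ℝ≥0}
  {fmin s t : ℝ} {γ : ℝ → EuclideanSpace ℝ (Fin N)}

/-- A shortest path with distinct endpoints on a small sphere enters the open ball bounded by it. -/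
theorem IsShortest.exists_dist_lt (hγ : IsShortest M f s t γ) (hM : IsClosed M)
    {R r : ℝ} (hU : UniqueProjection M (2 * R)) (hf : LipschitzOnWith κ f M)
    (hfmin : 0 < fmin) (hf_lower : ∀ z ∈ M, fmin ≤ f z) (hκ : 8 * κ * R ≤ fmin)
    {z : EuclideanSpace ℝ (Fin N)} (hrR : r < R) (hs : dist z (γ s) = r) (ht : dist z (γ t) = r)
    (hne : γ s ≠ γ t) : ∃ u ∈ Icc s t, dist z (γ u) < r := by
  by_contra! hout
  have hr : 0 ≤ r := hs ▸ dist_nonneg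
  have hR : 0 < R := hr.trans_lt hrR
  have hT : 0 < 2 * R := by positivity
  obtain ⟨K, hK⟩ := hγ.lipschitz
  have hDz : ∀ u ∈ Icc s t, dist (γ u) z ≤ 8 / 5 * r := fun u hu =>
    hγ.dist_le hM hT hU hf hfmin hf_lower (by linarith) (by linarith) hs ht hne hu
  have hD : 8 / 5 * r * (κ / fmin + 1 / (2 * R)) < 1 := by
    have h1 : (κ : ℝ) / fmin ≤ 1 / (8 * R) := by
      rw [div_le_div_iff₀ hfmin (by positivity)]; linarith
    have h2 : 8 / 5 * r * (κ / fmin + 1 / (2 * R)) ≤ 8 / 5 * r * (1 / (8 * R) + 1 / (2 * R)) := by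
      gcongr
    -- The constants match exactly: `8 / 5 * (1 / 8 + 1 / 2) = 1`.
    have h3 : 8 / 5 * r * (1 / (8 * R) + 1 / (2 * R)) = r / R := by field_simp; ring
    rw [h3] at h2
    exact h2.trans_lt ((div_lt_one hR).2 hrR)
  -- Pushing towards `z` by the power of the point shows that the path lies on the sphere.
  have hsph : ∀ u ∈ Icc s t, ‖γ u - z‖ ^ 2 - r ^ 2 = 0 := by
    refine hγ.eq_zero_of_monotone hM hT hU hf hfmin hf_lower hDz hD
      (Φ := fun x => ‖x - z‖ ^ 2 - r ^ 2) (((contDiff_id.sub contDiff_const).norm_sq ℝ).sub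
        contDiff_const) ?_ ?_ ?_ ?_
    · intro u hu
      have := hout u hu
      rw [dist_comm, dist_eq_norm] at this
      nlinarith
    · rw [← dist_eq_norm, dist_comm, hs, sub_self]
    · rw [← dist_eq_norm, dist_comm, ht, sub_self]
    · intro u _ hd
      have h := ((hd.hasDerivAt.sub_const z).norm_sq).sub_const (r ^ 2)
      rw [h.deriv, real_inner_comm]
      nlinarith [mul_self_nonneg (inner ℝ (deriv γ u) (γ u - z))]
  -- On the sphere every displacement is admissible; one that vanishes only at the endpoints is used.
  have hends : ∀ u ∈ Icc s t, ‖γ u - γ s‖ ^ 2 * ‖γ u - γ t‖ ^ 2 = 0 := by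
    refine hγ.eq_zero_of_monotone hM hT hU hf hfmin hf_lower hDz hD
      (Φ := fun x => ‖x - γ s‖ ^ 2 * ‖x - γ t‖ ^ 2)
      (((contDiff_id.sub contDiff_const).norm_sq ℝ).mul
        ((contDiff_id.sub contDiff_const).norm_sq ℝ)) ?_ ?_ ?_ ?_
    · intro u _; positivity
    · simp
    · simp
    · intro u hu hd
      have h := ((hd.hasDerivAt.sub_const z).norm_sq).sub_const (r ^ 2)
      have h0 : (fun v => ‖γ v - z‖ ^ 2 - r ^ 2) =ᶠ[𝓝 u] fun _ => 0 := by
        filter_upwards [Icc_mem_nhds hu.1 hu.2] with v hv using hsph v hv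
      have h1 := h.deriv
      rw [h0.deriv_eq, deriv_const, real_inner_comm] at h1
      have h2 : inner ℝ (deriv γ u) (γ u - z) = 0 := by linarith
      rw [h2, mul_zero]
  have hcont : ContinuousOn (fun u => dist (γ u) (γ s)) (Icc s t) :=
    (continuous_id.dist continuous_const).comp_continuousOn hK.continuousOn
  have hc : 0 < dist (γ t) (γ s) := dist_pos.2 hne.symm
  obtain ⟨u, hu, hu2⟩ := intermediate_value_Icc hγ.lt.le hcont
    (show dist (γ t) (γ s) / 2 ∈ Icc (dist (γ s) (γ s)) (dist (γ t) (γ s)) by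
      rw [dist_self]; constructor <;> linarith)
  simp only at hu2
  have h := hends u hu
  rw [← dist_eq_norm, ← dist_eq_norm] at h
  rcases mul_eq_zero.1 h with h | h <;> rw [sq_eq_zero_iff] at h
  · linarith
  · rw [dist_eq_zero.1 h] at hu2; linarith

theorem IsGeodesic.isShortest {x y : EuclideanSpace ℝ (Fin N)} {a b : ℝ}
    (hγ : IsGeodesic M f x y a b γ) (hfc : ContinuousOn f M) (hf : ∀ z ∈ M, 0 ≤ f z)
    (has : a ≤ s) (hst : s < t) (htb : t ≤ b) : IsShortest M f s t γ := by
  have hsub : Icc s t ⊆ Icc a b := Icc_subset_Icc has htb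
  obtain ⟨L, hL⟩ := hγ.isPath.lipschitz
  exact ⟨hst, ⟨L, hL.mono hsub⟩, hγ.isPath.mapsTo.mono_left hsub,
    fun η L hη hηM hs ht => hγ.conformalLength_le hfc hf has hst.le htb hη hηM hs ht⟩

/-- Two distinct nearest points of `z` on a minimizing geodesic would bound an arc that avoids the
open ball around `z` through them, and such an arc is not shortest. -/
theorem IsGeodesic.uniqueProjection_image {x y : EuclideanSpace ℝ (Fin N)} {a b : ℝ}
    (hγ : IsGeodesic M f x y a b γ) (hM : IsClosed M) {R : ℝ} (hU : UniqueProjection M (2 * R))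
    (hf : LipschitzOnWith κ f M) (hfmin : 0 < fmin) (hf_lower : ∀ z ∈ M, fmin ≤ f z)
    (hκ : 8 * κ * R ≤ fmin) : UniqueProjection (γ '' Icc a b) R := by
  intro z hz
  have hab := hγ.isPath.lt
  obtain ⟨L, hL⟩ := hγ.isPath.lipschitz
  have hCne : (γ '' Icc a b).Nonempty := ⟨_, a, left_mem_Icc.2 hab.le, rfl⟩
  rw [mem_thickening_iff_infDist_lt hCne] at hz
  have hCc : IsCompact (γ '' Icc a b) := isCompact_Icc.image_of_continuousOn hL.continuousOn
  have key : ∀ s ∈ Icc a b, ∀ t ∈ Icc a b, s < t → dist z (γ s) = infDist z (γ '' Icc a b) →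
      dist z (γ t) = infDist z (γ '' Icc a b) → γ s = γ t := by
    intro s hs t ht hst hzs hzt
    by_contra hne
    have hsh := hγ.isShortest hf.continuousOn (fun z hz => hfmin.le.trans (hf_lower z hz))
      hs.1 hst ht.2
    obtain ⟨u, hu, hlt⟩ := hsh.exists_dist_lt hM hU hf hfmin hf_lower hκ hz hzs hzt hne
    exact hlt.not_ge (infDist_le_dist_of_mem ⟨u, ⟨hs.1.trans hu.1, hu.2.trans ht.2⟩, rfl⟩)
  obtain ⟨p, hp, hpd⟩ := hCc.exists_infDist_eq_dist hCne z
  refine ⟨p, ⟨hp, hpd.symm⟩, ?_⟩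
  rintro q ⟨⟨t, ht, rfl⟩, hqd⟩
  obtain ⟨s, hs, rfl⟩ := hp
  rcases lt_trichotomy s t with h | h | h
  · exact (key s hs t ht h hpd.symm hqd).symm
  · rw [h]
  · exact key t ht s hs h hqd hpd.symm

theorem UniqueProjection.le_reach {S : Set (EuclideanSpace ℝ (Fin N))} {r : ℝ} (hr : 0 < r)
    (h : UniqueProjection S r) : ENNReal.ofReal r ≤ reach S :=
  le_iSup₂_of_le r ⟨hr, h⟩ le_rfl

theorem uniqueProjection_of_lt_reach {S : Set (EuclideanSpace ℝ (Fin N))} {r : ℝ}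
    (h : ENNReal.ofReal r < reach S) : UniqueProjection S r := by
  obtain ⟨T, hT⟩ := lt_iSup_iff.1 h
  obtain ⟨⟨hT0, hU⟩, hlt⟩ := lt_iSup_iff.1 hT
  have hU' : UniqueProjection S T := hU
  exact hU'.mono ((ENNReal.ofReal_lt_ofReal_iff hT0).1 hlt).le

theorem IsGeodesic.le_reach_image {x y : EuclideanSpace ℝ (Fin N)} {a b : ℝ}
    (hγ : IsGeodesic M f x y a b γ) (hM : IsClosed M) (hf : LipschitzOnWith κ f M)
    (hfmin : 0 < fmin) (hf_lower : ∀ z ∈ M, fmin ≤ f z) :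
    min (reach M / 2) (ENNReal.ofReal fmin / (8 * (κ : ℝ≥0∞))) ≤ reach (γ '' Icc a b) := by
  refine le_of_forall_lt fun c hc => ?_
  obtain ⟨c', hcc', hc'⟩ := exists_between hc
  have hfin : c' ≠ ⊤ := (hc'.trans_le le_top).ne
  obtain ⟨R, rfl⟩ : ∃ R : ℝ≥0, (R : ℝ≥0∞) = c' := ⟨c'.toNNReal, ENNReal.coe_toNNReal hfin⟩
  have hR0 : (0 : ℝ) < R := by
    have : (0 : ℝ≥0∞) < R := (zero_le).trans_lt hcc'
    exact_mod_cast this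
  obtain ⟨h1, h2⟩ := lt_min_iff.1 hc'
  have hU : UniqueProjection M (2 * R) := by
    apply uniqueProjection_of_lt_reach
    rw [ENNReal.lt_div_iff_mul_lt (by simp) (by simp)] at h1
    rw [mul_comm, ENNReal.ofReal_mul R.coe_nonneg, ENNReal.ofReal_coe_nnreal]
    simpa using h1
  have hκ : 8 * (κ : ℝ) * R ≤ fmin := by
    have h3 := ENNReal.mul_le_of_le_div h2.le
    rw [← ENNReal.ofReal_le_ofReal_iff hfmin.le]
    refine le_trans (le_of_eq ?_) h3
    rw [ENNReal.ofReal_mul (by positivity), ENNReal.ofReal_mul (by positivity)]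
    simp [mul_comm]
  refine hcc'.trans_le ?_
  rw [← ENNReal.ofReal_coe_nnreal]
  exact (hγ.uniqueProjection_image hM hU hf hfmin hf_lower hκ).le_reach hR0

end Reach

end ConformalMetric

theorem mainTheorem1 {N : ℕ} (M : Set (EuclideanSpace ℝ (Fin N)))
    (hM_closed : IsClosed M) (hM_conn : IsPathConnected M)
    (hM_reach : 0 < ConformalMetric.reach M)
    (f : EuclideanSpace ℝ (Fin N) → ℝ) (κ : ℝ≥0) (fmin : ℝ)
    (hf_lip : LipschitzOnWith κ f M) (hfmin : 0 < fmin) (hf_lower : ∀ z ∈ M, fmin ≤ f z) :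
    (∀ x ∈ M, ∀ y ∈ M, x ≠ y → ∀ (a b : ℝ) (γ : ℝ → EuclideanSpace ℝ (Fin N)),
      ConformalMetric.IsGeodesic M f x y a b γ →
        0 < ConformalMetric.reach (γ '' Set.Icc a b)) ∧
    min (ConformalMetric.reach M / 2) (ENNReal.ofReal fmin / (8 * (κ : ℝ≥0∞))) ≤
      ConformalMetric.conformalReach M f := by
  have hpos : 0 < min (ConformalMetric.reach M / 2)
      (ENNReal.ofReal fmin / (8 * (κ : ℝ≥0∞))) := by
    refine lt_min (ENNReal.div_pos hM_reach.ne' (by simp)) (ENNReal.div_pos ?_ ?_)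
    · simpa using hfmin
    · exact ENNReal.mul_ne_top (by simp) ENNReal.coe_ne_top
  constructor
  · intro x _ y _ _ a b γ hγ
    exact hpos.trans_le (hγ.le_reach_image hM_closed hf_lip hfmin hf_lower)
  · exact le_iInf₂ fun x _ => le_iInf₂ fun y _ => le_iInf fun _ => le_iInf₂ fun a b =>
      le_iInf₂ fun γ hγ => hγ.le_reach_image hM_closed hf_lip hfmin hf_lower
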